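/- Let $n,p,d\ge 1$, let $A=[A_1,\dots,A_d]$ with $A_i\in\mathbb R^{n\times m_i}$, and let $\mu>0$. Write $\mathcal S_{n,p}=\{Z\in\mathbb R^{n\times p}: Z^\top Z=I_p\}$, $\mathcal T_Z=\{Y: Y^\top Z+Z^\top Y=0\}$, $P^\perp_X=I_n-XX^\top$, $r(Z)=\mu\sum_{i,j}|Z_{ij}|$, $\langle Y_1,Y_2\rangle=\mathrm{tr}(Y_1^\top Y_2)$, and let $\|\cdot\|_F$, $\|\cdot\|_2$ be the Frobenius and spectral norms. The $\ell_1$-regularized sparse PCA problem is to minimize $-\tfrac12\mathrm{tr}(Z^\top AA^\top Z)+r(Z)$ over $Z\in\mathcal S_{n,p}$. A point $Z\in\mathcal S_{n,p}$ is a first-order stationary point of it if $0\in \mathrm{Proj}_{\mathcal T_Z}(-AA^\top Z+\partial r(Z))$, where $\partial r$ is the Clarke subgradient and $\mathrm{Proj}_{\mathcal T_Z}(Y)=P^\perp_Z Y+\tfrac12 Z(Z^\top Y-Y^\top Z)$. **Algorithm DSSAL1**, with parameters $\eta,c_i,c_i',\delta_i,\beta_i$ ($i=1,\dots,d$). Choose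 $Z^{(0)}\in\mathcal S_{n,p}$ and set $X_i^{(0)}=Z^{(0)}$. For all $k\ge 0$ and all $i$ let $$W_i^{(k)}=-P^\perp_{X_i^{(k)}}A_iA_i^\top X_i^{(k)},\qquad \Lambda_i^{(k)}=X_i^{(k)}(W_i^{(k)})^\top+W_i^{(k)}(X_i^{(k)})^\top,\qquad Q^{(k)}=\sum_{i=1}^d\bigl(\Lambda_i^{(k)}-\beta_iX_i^{(k)}(X_i^{(k)})^\top\bigr).$$ For $k=0,1,2,\dots$: 1. $D^{(k)}$ is the minimizer of $\langle Q^{(k)}Z^{(k)},D\rangle+\frac1{2\eta}\|D\|_F^2+r(Z^{(k)}+D)$ over $D\in\mathcal T_{Z^{(k)}}$. 2. $Z^{(k+1)}=UV^\top$, where $U\Sigma V^\top$ is an economic singular value decomposition of $Z^{(k)}+D^{(k)}$. 3. For each $i$, with $H_i^{(k)}=A_iA_i^\top+\Lambda_i^{(k)}+\beta_iZ^{(k+1)}(Z^{(k+1)})^\top$ and $h_i^{(k)}(X)=-\frac12\mathrm{tr}(X^\top H_i^{(k)}X)$, the point $X_i^{(k+1)}$ is any point of $\mathcal S_{n,p}$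 such that $$h_i^{(k)}(X_i^{(k)})-h_i^{(k)}(X_i^{(k+1)})\ge\frac{c_i}{c_i'\|A_i\|_2^2+\beta_i}\bigl\|P^\perp_{X_i^{(k)}}H_i^{(k)}X_i^{(k)}\bigr\|_F^2,$$ $$\bigl\|P^\perp_{X_i^{(k+1)}}H_i^{(k)}X_i^{(k+1)}\bigr\|_F\le\delta_i\bigl\|P^\perp_{X_i^{(k)}}H_i^{(k)}X_i^{(k)}\bigr\|_F.$$ **Conditions on the parameters**, with auxiliary parameters $\rho\ge1$ and $\underline\sigma\in(0,1)$. For all $i$: $c_i,c_i',\beta_i>0$, $\delta_i\in[0,1)$, and $$0<\eta<\frac1{2\bar M},\qquad \delta_i<\frac{\underline\sigma}{2\sqrt{\rho d}},\qquad \underline\sigma<\min\Bigl\{1,\frac1{\sqrt{c_i}}\Bigr\},\qquad \bar M=\frac{\mu\sqrt{np}}2+2\|A\|_F^2+\sqrt p\sum_{i=1}^d\beta_i,$$ $$\beta_i\ge\max\Bigl\{\xi_i\|A_i\|_2^2,\ \frac{8(\mu np+\sqrt p\|A\|_F^2)}{1-\underline\sigma^2},\ \frac{6\sqrt p\|A_i\|_F^2}{c_i\underline\sigma^2(1-\underline\sigma^2)}\Bigr\},$$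 $$\xi_i=\max\Bigl\{c_i',\ \frac{4\sqrt2}{\underline\sigma},\ \frac{4(2\sqrt{\rho d}+\sqrt2)}{\underline\sigma-2\sqrt{\rho d}\,\delta_i},\ \frac{4(\sqrt{2\rho d}+1)}{c_i\underline\sigma^2\rho d}\Bigr\},$$ and $\beta_i\le\rho\beta_j$ for all $i,j$. **Theorem.** Under these conditions there is a constant $C>0$, depending only on the data $A_1,\dots,A_d,\mu,n,p,d$ and on the parameters, such that for every infinite iterate sequence generated by DSSAL1 from an arbitrary $Z^{(0)}\in\mathcal S_{n,p}$: - $\{Z^{(k)}\}$ has at least one accumulation point, and every accumulation point is a first-order stationary point of the sparse PCA problem; - for every integer $K>1$, $$\min_{k=1,\dots,K}\Bigl\{\|D^{(k)}\|_F^2+\frac1d\sum_{i=1}^d\bigl\|Z^{(k)}(Z^{(k)})^\top-X_i^{(k)}(X_i^{(k)})^\top\bigr\|_F^2\Bigr\}\le\frac CK .$$ -/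

import Mathlib

open Matrix Filter Topology

noncomputable section

namespace SparsePCA

/-! ### Matrix notions -/

/-- The Euclidean inner product `⟨Y₁, Y₂⟩ = tr (Y₁ᵀ Y₂)` of two matrices of the same size. -/
def matInner {a b : ℕ} (Y₁ Y₂ : Matrix (Fin a) (Fin b) ℝ) : ℝ := (Y₁ᵀ * Y₂).trace

section FrobeniusNorm

attribute [local instance] Matrix.frobeniusNormedAddCommGroup

/-- The Frobenius norm. -/
def frobNorm {ι κ : Type*} [Fintype ι] [Fintype κ] (M : Matrix ι κ ℝ) : ℝ := ‖M‖

end FrobeniusNorm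

section SpectralNorm

attribute [local instance] Matrix.instL2OpNormedAddCommGroup

/-- The spectral norm (the operator norm for the Euclidean norms). -/
def specNorm {ι κ : Type*} [Fintype ι] [Fintype κ] [DecidableEq κ] (M : Matrix ι κ ℝ) : ℝ := ‖M‖

end SpectralNorm

/-- The Stiefel manifold `{Z ∈ ℝ^{n×p} ∣ Zᵀ Z = I_p}`. -/
def stiefel (n p : ℕ) : Set (Matrix (Fin n) (Fin p) ℝ) := {Z | Zᵀ * Z = 1}

/-- The tangent space `{Y ∣ Yᵀ Z + Zᵀ Y = 0}` of the Stiefel manifold at `Z`. -/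
def tangentSpace {n p : ℕ} (Z : Matrix (Fin n) (Fin p) ℝ) : Set (Matrix (Fin n) (Fin p) ℝ) :=
  {Y | Yᵀ * Z + Zᵀ * Y = 0}

/-- `P_X^⊥ = I_n - X Xᵀ`. -/
def perpProj {n p : ℕ} (X : Matrix (Fin n) (Fin p) ℝ) : Matrix (Fin n) (Fin n) ℝ := 1 - X * Xᵀ

/-- The orthogonal projection of `Y` onto the tangent space at a point `Z` of the Stiefel manifold,
`(I_n - Z Zᵀ) Y + Z (Zᵀ Y - Yᵀ Z) / 2`. -/
def tangentProj {n p : ℕ} (Z Y : Matrix (Fin n) (Fin p) ℝ) : Matrix (Fin n) (Fin p) ℝ :=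
  perpProj Z * Y + (1 / 2 : ℝ) • (Z * (Zᵀ * Y - Yᵀ * Z))

/-- `Y` is the projection `U Vᵀ` of `C` onto the Stiefel manifold, where `C = U diag(s) Vᵀ` is an
economic singular value decomposition of `C`. -/
def IsStiefelProj {n p : ℕ} (C Y : Matrix (Fin n) (Fin p) ℝ) : Prop :=
  ∃ (U : Matrix (Fin n) (Fin p) ℝ) (s : Fin p → ℝ) (V : Matrix (Fin p) (Fin p) ℝ),
    U ∈ stiefel n p ∧ V ∈ stiefel p p ∧ (∀ j, 0 ≤ s j) ∧
      C = U * Matrix.diagonal s * Vᵀ ∧ Y = U * Vᵀ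

/-! ### Clarke subgradients -/

/-- Clarke's generalized directional derivative of a (Lipschitz continuous) function `f` at `X`
along `H`: the upper limit of `(f (Y + t H) - f Y) / t` as `Y → X` and `t → 0⁺`. -/
def clarkeDeriv {n p : ℕ} (f : Matrix (Fin n) (Fin p) ℝ → ℝ) (X H : Matrix (Fin n) (Fin p) ℝ) : ℝ :=
  Filter.limsup (fun q : Matrix (Fin n) (Fin p) ℝ × ℝ => (f (q.1 + q.2 • H) - f q.1) / q.2)
    (𝓝 X ×ˢ 𝓝[>] (0 : ℝ))

/-- The Clarke subgradient `∂f(X)` of a (Lipschitz continuous) function `f`. -/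
def clarkeSubgradient {n p : ℕ} (f : Matrix (Fin n) (Fin p) ℝ → ℝ) (X : Matrix (Fin n) (Fin p) ℝ) :
    Set (Matrix (Fin n) (Fin p) ℝ) :=
  {G | ∀ H, matInner G H ≤ clarkeDeriv f X H}

/-! ### The sparse PCA problem -/

/-- The regularizer `r(Z) = μ ∑_{i,j} |Z_{ij}|`. -/
def reg {n p : ℕ} (μ : ℝ) (Z : Matrix (Fin n) (Fin p) ℝ) : ℝ := μ * ∑ i, ∑ j, |Z i j|

/-- The data matrix `A = [A_1, …, A_d]` made of the column blocks `A_i`. -/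
def dataMatrix {n d : ℕ} {m : Fin d → ℕ} (A : ∀ i, Matrix (Fin n) (Fin (m i)) ℝ) :
    Matrix (Fin n) (Σ i, Fin (m i)) ℝ :=
  Matrix.of fun row col => A col.1 row col.2

/-- `Z` is a first-order stationary point of the problem of minimizing
`-(1/2) tr (Zᵀ A Aᵀ Z) + μ ‖Z‖₁` over the Stiefel manifold: `Z` is feasible and
`0 ∈ Proj_{T_Z} (-A Aᵀ Z + ∂r(Z))`. -/
def IsStationary {n p d : ℕ} {m : Fin d → ℕ} (A : ∀ i, Matrix (Fin n) (Fin (m i)) ℝ) (μ : ℝ)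
    (Z : Matrix (Fin n) (Fin p) ℝ) : Prop :=
  Z ∈ stiefel n p ∧
    ∃ R ∈ clarkeSubgradient (reg μ) Z,
      tangentProj Z (-(dataMatrix A * (dataMatrix A)ᵀ * Z) + R) = 0

/-! ### The algorithm -/

/-- The parameters: the step size `η`, the auxiliary parameters `ρ` and `σ`, the constants `c_i`,
`c_i'` and `δ_i` of the inexactness conditions, and the penalty parameters `β_i`. -/
structure Params (d : ℕ) where
  η : ℝ
  ρ : ℝ
  σ : ℝ
  c : Fin d → ℝ
  c' : Fin d → ℝ
  δ : Fin d → ℝ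
  β : Fin d → ℝ

/-- `W_i = -P_{X_i}^⊥ A_i A_iᵀ X_i`. -/
def wMat {n p k : ℕ} (Ai : Matrix (Fin n) (Fin k) ℝ) (X : Matrix (Fin n) (Fin p) ℝ) :
    Matrix (Fin n) (Fin p) ℝ :=
  -(perpProj X * Ai * Aiᵀ * X)

/-- The multiplier `Λ_i = X_i W_iᵀ + W_i X_iᵀ`. -/
def multiplier {n p k : ℕ} (Ai : Matrix (Fin n) (Fin k) ℝ) (X : Matrix (Fin n) (Fin p) ℝ) :
    Matrix (Fin n) (Fin n) ℝ :=
  X * (wMat Ai X)ᵀ + wMat Ai X * Xᵀ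

/-- `Q = ∑_i (Λ_i - β_i X_i X_iᵀ)`. -/
def qMat {n p d : ℕ} (β : Fin d → ℝ) (X : Fin d → Matrix (Fin n) (Fin p) ℝ)
    (Lam : Fin d → Matrix (Fin n) (Fin n) ℝ) : Matrix (Fin n) (Fin n) ℝ :=
  ∑ i, (Lam i - β i • (X i * (X i)ᵀ))

/-- The objective `D ↦ ⟨Q Z, D⟩ + (1/(2η)) ‖D‖_F² + r(Z + D)` of the proximal subproblem. -/
def proxObjective {n p : ℕ} (μ η : ℝ) (Q : Matrix (Fin n) (Fin n) ℝ)
    (Z D : Matrix (Fin n) (Fin p) ℝ) : ℝ :=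
  matInner (Q * Z) D + 1 / (2 * η) * frobNorm D ^ 2 + reg μ (Z + D)

/-- `H_i = A_i A_iᵀ + Λ_i + β_i Z Zᵀ`. -/
def hMat {n p k : ℕ} (Ai : Matrix (Fin n) (Fin k) ℝ) (βi : ℝ) (Lam : Matrix (Fin n) (Fin n) ℝ)
    (Z : Matrix (Fin n) (Fin p) ℝ) : Matrix (Fin n) (Fin n) ℝ :=
  Ai * Aiᵀ + Lam + βi • (Z * Zᵀ)

/-- The objective `h(X) = -(1/2) tr (Xᵀ H X)` of a local subproblem. -/
def localObjective {n p : ℕ} (H : Matrix (Fin n) (Fin n) ℝ) (X : Matrix (Fin n) (Fin p) ℝ) : ℝ :=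
  -(1 / 2) * (Xᵀ * H * X).trace

/-- The sequences `Z^(k)`, `D^(k)`, `X_i^(k)`, `Λ_i^(k)` are generated by the algorithm DSSAL1. -/
structure IsDSSAL1Run {n p d : ℕ} {m : Fin d → ℕ} (A : ∀ i, Matrix (Fin n) (Fin (m i)) ℝ) (μ : ℝ)
    (P : Params d) (Z D : ℕ → Matrix (Fin n) (Fin p) ℝ)
    (X : ℕ → Fin d → Matrix (Fin n) (Fin p) ℝ) (Lam : ℕ → Fin d → Matrix (Fin n) (Fin n) ℝ) :
    Prop where
  Z_zero : Z 0 ∈ stiefel n p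
  X_zero : ∀ i, X 0 i = Z 0
  multiplier_eq : ∀ k i, Lam k i = multiplier (A i) (X k i)
  D_mem : ∀ k, D k ∈ tangentSpace (Z k)
  D_min : ∀ k, IsMinOn (proxObjective μ P.η (qMat P.β (X k) (Lam k)) (Z k)) (tangentSpace (Z k)) (D k)
  Z_succ : ∀ k, IsStiefelProj (Z k + D k) (Z (k + 1))
  X_succ_mem : ∀ k i, X (k + 1) i ∈ stiefel n p
  X_succ_decrease : ∀ k i,
    P.c i / (P.c' i * specNorm (A i) ^ 2 + P.β i) *
        frobNorm (perpProj (X k i) * hMat (A i) (P.β i) (Lam k i) (Z (k + 1)) * X k i) ^ 2 ≤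
      localObjective (hMat (A i) (P.β i) (Lam k i) (Z (k + 1))) (X k i) -
        localObjective (hMat (A i) (P.β i) (Lam k i) (Z (k + 1))) (X (k + 1) i)
  X_succ_kkt : ∀ k i,
    frobNorm (perpProj (X (k + 1) i) * hMat (A i) (P.β i) (Lam k i) (Z (k + 1)) * X (k + 1) i) ≤
      P.δ i * frobNorm (perpProj (X k i) * hMat (A i) (P.β i) (Lam k i) (Z (k + 1)) * X k i)

/-! ### The conditions on the parameters -/

/-- `M̄ = μ √(np) / 2 + 2 ‖A‖_F² + √p ∑_i β_i`. -/
def Mbar {n d : ℕ} (p : ℕ) {m : Fin d → ℕ} (A : ∀ i, Matrix (Fin n) (Fin (m i)) ℝ) (μ : ℝ)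
    (P : Params d) : ℝ :=
  μ * √((n : ℝ) * p) / 2 + 2 * frobNorm (dataMatrix A) ^ 2 + √(p : ℝ) * ∑ i, P.β i

/-- The condition on the step size and on the inexactness constants. -/
structure StepCondition {n d : ℕ} (p : ℕ) {m : Fin d → ℕ}
    (A : ∀ i, Matrix (Fin n) (Fin (m i)) ℝ) (μ : ℝ) (P : Params d) : Prop where
  η_pos : 0 < P.η
  η_lt : P.η < 1 / (2 * Mbar p A μ P)
  c_pos : ∀ i, 0 < P.c i
  c'_pos : ∀ i, 0 < P.c' i
  one_le_ρ : 1 ≤ P.ρ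
  δ_nonneg : ∀ i, 0 ≤ P.δ i
  δ_lt_one : ∀ i, P.δ i < 1
  δ_lt : ∀ i, P.δ i < P.σ / (2 * √(P.ρ * d))
  σ_pos : 0 < P.σ
  σ_lt_one : P.σ < 1
  σ_lt : ∀ i, P.σ < 1 / √(P.c i)

/-- The constant `ξ_i`. -/
def xi {d : ℕ} (P : Params d) (i : Fin d) : ℝ :=
  max (P.c' i) (max (4 * √2 / P.σ)
    (max (4 * (2 * √(P.ρ * d) + √2) / (P.σ - 2 * √(P.ρ * d) * P.δ i))
      (4 * (√(2 * P.ρ * d) + 1) / (P.c i * P.σ ^ 2 * P.ρ * d))))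

/-- The condition on the penalty parameters. -/
structure PenaltyCondition {n d : ℕ} (p : ℕ) {m : Fin d → ℕ}
    (A : ∀ i, Matrix (Fin n) (Fin (m i)) ℝ) (μ : ℝ) (P : Params d) : Prop where
  β_pos : ∀ i, 0 < P.β i
  β_lower : ∀ i,
    max (xi P i * specNorm (A i) ^ 2)
      (max (8 * (μ * n * p + √(p : ℝ) * frobNorm (dataMatrix A) ^ 2) / (1 - P.σ ^ 2))
        (6 * √(p : ℝ) * frobNorm (A i) ^ 2 / (P.c i * P.σ ^ 2 * (1 - P.σ ^ 2)))) ≤ P.β i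
  β_ratio : ∀ i j, P.β i ≤ P.ρ * P.β j

end SparsePCA

end

/-! The proof is a descent argument for the augmented Lagrangian `lagrangian`, in which every
multiplier is the explicit function `multiplier (A i) (X i)` of the local variable. All coupling
goes through the projectors `X i * (X i)ᵀ` and `Z * Zᵀ`. Two facts make this work. The multiplier
cancels the data term of the local residual (`perpProj_mul_add_multiplier_mul`), so that residual is
β times the gradient of the consensus penalty; and the multiplier is Lipschitz in the projector with
constant `2 * specNorm A ^ 2`, so changing it is cheap when β is large.

For the global step, the strong convexity of the proximal subproblem beats the second-order errors
of the retraction and of the quadratic form, and the Lagrangian drops by `Mbar * ‖D‖²`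
(`lagrangian_retraction_decrease`). For a local step, let e and f be the projector distances to the
new Z before and after it. If e² ≤ 2(1 - σ²), the penalty gradient controls the distance from below
(`le_frobNorm_perpProj_mul_projector_mul_sq`). The decrease condition then gains a multiple of βe²,
the approximate stationarity condition gives the contraction 2ρd f² ≤ e², and the multiplier update
costs at most half of the gain.

The neighbourhood is preserved by induction: ρd · dist² ≤ 1 - σ² holds at the start, the global step
can only loosen it to dist² ≤ 2(1 - σ²) because the Lagrangian does not increase and β is large, and
the contraction restores it (`IsDSSAL1Run.step`). Since the Lagrangian is bounded on the Stiefel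
manifold, the squared steps and consensus errors are summable, which gives both the rate and their
convergence to zero.

At an accumulation point all projectors agree and `0` solves the limiting proximal problem.
Hahn–Banach turns this into a Clarke subgradient, and at consensus Q Z differs from -A Aᵀ Z only by
a normal vector (`qMat_consensus_mul`). -/

namespace SparsePCA

/-! ### The Frobenius norm and the spectral norm -/

section Norms

attribute [local instance] Matrix.frobeniusNormedAddCommGroup Matrix.frobeniusNormedSpace

variable {ι κ τ : Type*} [Fintype ι] [Fintype κ] [Fintype τ]

lemma frobNorm_nonneg (M : Matrix ι κ ℝ) : 0 ≤ frobNorm M := norm_nonneg M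

lemma frobNorm_add_le (M N : Matrix ι κ ℝ) : frobNorm (M + N) ≤ frobNorm M + frobNorm N :=
  norm_add_le M N

lemma frobNorm_sub_le (M N : Matrix ι κ ℝ) : frobNorm (M - N) ≤ frobNorm M + frobNorm N :=
  norm_sub_le M N

lemma frobNorm_sub_le_add (M N K : Matrix ι κ ℝ) :
    frobNorm (M - K) ≤ frobNorm (M - N) + frobNorm (N - K) :=
  norm_sub_le_norm_sub_add_norm_sub M N K

lemma frobNorm_sub_comm (M N : Matrix ι κ ℝ) : frobNorm (M - N) = frobNorm (N - M) :=
  norm_sub_rev M N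

lemma frobNorm_neg (M : Matrix ι κ ℝ) : frobNorm (-M) = frobNorm M := norm_neg M

lemma frobNorm_smul (c : ℝ) (M : Matrix ι κ ℝ) : frobNorm (c • M) = |c| * frobNorm M :=
  norm_smul c M

lemma frobNorm_sum_le {α : Type*} (s : Finset α) (M : α → Matrix ι κ ℝ) :
    frobNorm (∑ a ∈ s, M a) ≤ ∑ a ∈ s, frobNorm (M a) :=
  norm_sum_le s M

lemma frobNorm_mul_le (M : Matrix ι κ ℝ) (N : Matrix κ τ ℝ) :
    frobNorm (M * N) ≤ frobNorm M * frobNorm N :=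
  Matrix.frobenius_norm_mul M N

lemma frobNorm_transpose (M : Matrix ι κ ℝ) : frobNorm Mᵀ = frobNorm M :=
  Matrix.frobenius_norm_transpose M

lemma frobNorm_eq_zero {M : Matrix ι κ ℝ} : frobNorm M = 0 ↔ M = 0 := norm_eq_zero

lemma frobNorm_sq_eq_sum (M : Matrix ι κ ℝ) : frobNorm M ^ 2 = ∑ i, ∑ j, M i j ^ 2 := by
  have h : frobNorm M = (∑ i, ∑ j, ‖M i j‖ ^ (2 : ℝ)) ^ (1 / 2 : ℝ) := Matrix.frobenius_norm_def M
  have hs : (∑ i, ∑ j, ‖M i j‖ ^ (2 : ℝ)) = ∑ i, ∑ j, M i j ^ 2 := by simp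
  rw [h, hs, ← Real.sqrt_eq_rpow, Real.sq_sqrt]
  positivity

lemma trace_transpose_mul_eq_sum (M N : Matrix ι κ ℝ) :
    (Mᵀ * N).trace = ∑ i, ∑ j, M i j * N i j := by
  simp only [Matrix.trace, Matrix.diag, Matrix.mul_apply, Matrix.transpose_apply]
  exact Finset.sum_comm

lemma frobNorm_sq (M : Matrix ι κ ℝ) : frobNorm M ^ 2 = (Mᵀ * M).trace := by
  rw [frobNorm_sq_eq_sum, trace_transpose_mul_eq_sum]
  simp only [sq]

lemma frobNorm_add_sq (M N : Matrix ι κ ℝ) :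
    frobNorm (M + N) ^ 2 = frobNorm M ^ 2 + 2 * (Mᵀ * N).trace + frobNorm N ^ 2 := by
  simp only [frobNorm_sq_eq_sum, trace_transpose_mul_eq_sum, Finset.mul_sum,
    ← Finset.sum_add_distrib, Matrix.add_apply]
  refine Finset.sum_congr rfl fun i _ => Finset.sum_congr rfl fun j _ => by ring

lemma frobNorm_sub_sq (M N : Matrix ι κ ℝ) :
    frobNorm (M - N) ^ 2 = frobNorm M ^ 2 - 2 * (Mᵀ * N).trace + frobNorm N ^ 2 := by
  rw [sub_eq_add_neg, frobNorm_add_sq, frobNorm_neg, Matrix.mul_neg, Matrix.trace_neg]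
  ring

lemma abs_trace_transpose_mul_le (M N : Matrix ι κ ℝ) :
    |(Mᵀ * N).trace| ≤ frobNorm M * frobNorm N := by
  refine abs_le_of_sq_le_sq ?_ (mul_nonneg (frobNorm_nonneg _) (frobNorm_nonneg _))
  rw [mul_pow, frobNorm_sq_eq_sum, frobNorm_sq_eq_sum, trace_transpose_mul_eq_sum]
  simp only [← Finset.sum_product', Finset.univ_product_univ]
  exact Finset.sum_mul_sq_le_sq_mul_sq _ (fun x : ι × κ => M x.1 x.2) (fun x : ι × κ => N x.1 x.2)

lemma trace_transpose_mul_le (M N : Matrix ι κ ℝ) :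
    (Mᵀ * N).trace ≤ frobNorm M * frobNorm N :=
  (le_abs_self _).trans (abs_trace_transpose_mul_le M N)

lemma sum_abs_le_frobNorm (M : Matrix ι κ ℝ) :
    ∑ i, ∑ j, |M i j| ≤ √((Fintype.card ι : ℝ) * Fintype.card κ) * frobNorm M := by
  refine le_of_abs_le (abs_le_of_sq_le_sq ?_ (mul_nonneg (Real.sqrt_nonneg _) (frobNorm_nonneg _)))
  rw [mul_pow, Real.sq_sqrt (by positivity), frobNorm_sq_eq_sum]
  simp only [← Finset.sum_product', Finset.univ_product_univ]
  have h := sq_sum_le_card_mul_sum_sq (s := (Finset.univ : Finset (ι × κ)))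
    (f := fun x => |M x.1 x.2|)
  simpa [Fintype.card_prod] using h

variable [DecidableEq κ]

/-- Multiplication from the left by a matrix with orthonormal columns is an isometry. -/
lemma frobNorm_mul_of_transpose_mul_self_eq_one {U : Matrix ι κ ℝ} (hU : Uᵀ * U = 1)
    (M : Matrix κ τ ℝ) : frobNorm (U * M) = frobNorm M := by
  have h : frobNorm (U * M) ^ 2 = frobNorm M ^ 2 := by
    rw [frobNorm_sq, frobNorm_sq, Matrix.transpose_mul, Matrix.mul_assoc, ← Matrix.mul_assoc Uᵀ,
      hU, Matrix.one_mul]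
  exact (sq_eq_sq₀ (frobNorm_nonneg _) (frobNorm_nonneg _)).1 h

lemma frobNorm_mul_transpose_of_transpose_mul_self_eq_one {U : Matrix ι κ ℝ} (hU : Uᵀ * U = 1)
    (M : Matrix τ κ ℝ) : frobNorm (M * Uᵀ) = frobNorm M := by
  rw [← frobNorm_transpose, Matrix.transpose_mul, Matrix.transpose_transpose,
    frobNorm_mul_of_transpose_mul_self_eq_one hU, frobNorm_transpose]

lemma frobNorm_mul_le_specNorm_mul (M : Matrix ι κ ℝ) (N : Matrix κ τ ℝ) :
    frobNorm (M * N) ≤ specNorm M * frobNorm N := by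
  have hM : 0 ≤ specNorm M := by
    let := Matrix.instL2OpNormedAddCommGroup (m := ι) (n := κ) (𝕜 := ℝ)
    exact norm_nonneg M
  refine le_of_abs_le (abs_le_of_sq_le_sq ?_ (mul_nonneg hM (frobNorm_nonneg _)))
  rw [mul_pow, frobNorm_sq_eq_sum, frobNorm_sq_eq_sum, Finset.sum_comm,
    Finset.sum_comm (s := (Finset.univ : Finset κ)), Finset.mul_sum]
  refine Finset.sum_le_sum fun j _ => ?_
  have h := Matrix.l2_opNorm_mulVec M (WithLp.toLp 2 fun i => N i j)
  have h2 := pow_le_pow_left₀ (norm_nonneg _) h 2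
  rw [mul_pow, EuclideanSpace.norm_sq_eq, EuclideanSpace.norm_sq_eq] at h2
  simpa [specNorm, Matrix.mul_apply, Matrix.mulVec, dotProduct] using h2

lemma specNorm_nonneg (M : Matrix ι κ ℝ) : 0 ≤ specNorm M := by
  let := Matrix.instL2OpNormedAddCommGroup (m := ι) (n := κ) (𝕜 := ℝ)
  exact norm_nonneg M

lemma specNorm_transpose [DecidableEq ι] (M : Matrix ι κ ℝ) : specNorm Mᵀ = specNorm M := by
  simpa [specNorm] using Matrix.l2_opNorm_conjTranspose M

lemma frobNorm_mul_transpose_mul_le [DecidableEq ι] (M : Matrix ι κ ℝ) (N : Matrix ι τ ℝ) :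
    frobNorm (M * Mᵀ * N) ≤ specNorm M ^ 2 * frobNorm N := by
  rw [Matrix.mul_assoc, sq, mul_assoc]
  refine (frobNorm_mul_le_specNorm_mul _ _).trans ?_
  refine mul_le_mul_of_nonneg_left ?_ (specNorm_nonneg M)
  simpa [specNorm_transpose] using frobNorm_mul_le_specNorm_mul Mᵀ N

end Norms

/-! ### Points of the Stiefel manifold and their projectors -/

section Stiefel

variable {n p : ℕ}

lemma frobNorm_sq_of_mem_stiefel {X : Matrix (Fin n) (Fin p) ℝ} (hX : X ∈ stiefel n p) :
    frobNorm X ^ 2 = p := by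
  have h : Xᵀ * X = 1 := hX
  rw [frobNorm_sq, h]
  simp

lemma frobNorm_of_mem_stiefel {X : Matrix (Fin n) (Fin p) ℝ} (hX : X ∈ stiefel n p) :
    frobNorm X = √(p : ℝ) := by
  rw [← frobNorm_sq_of_mem_stiefel hX, Real.sqrt_sq (frobNorm_nonneg _)]

lemma frobNorm_mul_transpose_self_of_mem_stiefel {X : Matrix (Fin n) (Fin p) ℝ}
    (hX : X ∈ stiefel n p) : frobNorm (X * Xᵀ) = √(p : ℝ) := by
  rw [frobNorm_mul_of_transpose_mul_self_eq_one hX, frobNorm_transpose,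
    frobNorm_of_mem_stiefel hX]

lemma projector_mul_self {X : Matrix (Fin n) (Fin p) ℝ} (hX : X ∈ stiefel n p) :
    X * Xᵀ * (X * Xᵀ) = X * Xᵀ := by
  have h : Xᵀ * X = 1 := hX
  rw [Matrix.mul_assoc, ← Matrix.mul_assoc Xᵀ, h, Matrix.one_mul]

lemma projector_transpose (X : Matrix (Fin n) (Fin p) ℝ) : (X * Xᵀ)ᵀ = X * Xᵀ := by
  rw [Matrix.transpose_mul, Matrix.transpose_transpose]

lemma perpProj_transpose (X : Matrix (Fin n) (Fin p) ℝ) : (perpProj X)ᵀ = perpProj X := by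
  rw [perpProj, Matrix.transpose_sub, Matrix.transpose_one, projector_transpose]

lemma perpProj_mul_self {X : Matrix (Fin n) (Fin p) ℝ} (hX : X ∈ stiefel n p) :
    perpProj X * perpProj X = perpProj X := by
  rw [perpProj, Matrix.sub_mul, Matrix.one_mul, Matrix.mul_sub, projector_mul_self hX]
  simp

lemma perpProj_mul {X : Matrix (Fin n) (Fin p) ℝ} (hX : X ∈ stiefel n p) :
    perpProj X * X = 0 := by
  have h : Xᵀ * X = 1 := hX
  rw [perpProj, Matrix.sub_mul, Matrix.mul_assoc, h]
  simp

lemma transpose_mul_perpProj {X : Matrix (Fin n) (Fin p) ℝ} (hX : X ∈ stiefel n p) :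
    Xᵀ * perpProj X = 0 := by
  rw [← perpProj_transpose, ← Matrix.transpose_mul, perpProj_mul hX, Matrix.transpose_zero]

/-- An orthogonal projector does not increase the Frobenius norm. -/
lemma frobNorm_mul_le_of_projector {κ : Type*} [Fintype κ] {P : Matrix (Fin n) (Fin n) ℝ}
    (hP : P * P = P) (hPt : Pᵀ = P) (M : Matrix (Fin n) κ ℝ) :
    frobNorm (P * M) ≤ frobNorm M := by
  have h : frobNorm (M - P * M) ^ 2 = frobNorm M ^ 2 - frobNorm (P * M) ^ 2 := by
    rw [frobNorm_sub_sq, frobNorm_sq (P * M), Matrix.transpose_mul, hPt, Matrix.mul_assoc Mᵀ P,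
      ← Matrix.mul_assoc P, hP]
    ring
  exact le_of_abs_le (abs_le_of_sq_le_sq (by nlinarith [sq_nonneg (frobNorm (M - P * M))])
    (frobNorm_nonneg _))

lemma frobNorm_perpProj_mul_le {κ : Type*} [Fintype κ] {X : Matrix (Fin n) (Fin p) ℝ}
    (hX : X ∈ stiefel n p) (M : Matrix (Fin n) κ ℝ) :
    frobNorm (perpProj X * M) ≤ frobNorm M :=
  frobNorm_mul_le_of_projector (perpProj_mul_self hX) (perpProj_transpose X) M

/-- M X has the same norm as M X Xᵀ, and X Xᵀ is an orthogonal projector. -/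
lemma frobNorm_mul_projector_le {X : Matrix (Fin n) (Fin p) ℝ} (hX : X ∈ stiefel n p)
    (M : Matrix (Fin n) (Fin n) ℝ) : frobNorm (M * X) ≤ frobNorm M := by
  rw [← frobNorm_mul_transpose_of_transpose_mul_self_eq_one hX, Matrix.mul_assoc,
    ← frobNorm_transpose, Matrix.transpose_mul, projector_transpose, ← frobNorm_transpose M]
  exact frobNorm_mul_le_of_projector (projector_mul_self hX) (projector_transpose X) _

/-- The reflection `1 - 2 P` of a projector is an isometry. -/
lemma reflection_transpose_mul_self {X : Matrix (Fin n) (Fin p) ℝ} (hX : X ∈ stiefel n p) :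
    (1 - (2 : ℝ) • (X * Xᵀ))ᵀ * (1 - (2 : ℝ) • (X * Xᵀ)) = 1 := by
  rw [Matrix.transpose_sub, Matrix.transpose_smul, projector_transpose, Matrix.transpose_one]
  simp only [Matrix.sub_mul, Matrix.mul_sub, Matrix.one_mul, Matrix.mul_one, Matrix.smul_mul,
    Matrix.mul_smul, projector_mul_self hX]
  module

lemma frobNorm_sub_projector_le {X Z : Matrix (Fin n) (Fin p) ℝ} (hX : X ∈ stiefel n p)
    (hZ : Z ∈ stiefel n p) : frobNorm (Z * Zᵀ - X * Xᵀ) ≤ 2 * √(p : ℝ) := by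
  refine (frobNorm_sub_le _ _).trans ?_
  rw [frobNorm_mul_transpose_self_of_mem_stiefel hX, frobNorm_mul_transpose_self_of_mem_stiefel hZ]
  linarith

lemma frobNorm_sub_projector_sq {X Z : Matrix (Fin n) (Fin p) ℝ} (hX : X ∈ stiefel n p)
    (hZ : Z ∈ stiefel n p) :
    frobNorm (Z * Zᵀ - X * Xᵀ) ^ 2 = 2 * p - 2 * (Z * Zᵀ * (X * Xᵀ)).trace := by
  rw [frobNorm_sub_sq, frobNorm_mul_transpose_self_of_mem_stiefel hX,
    frobNorm_mul_transpose_self_of_mem_stiefel hZ, Real.sq_sqrt (Nat.cast_nonneg _),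
    projector_transpose]
  ring

/-- Both sides equal 2p - 2‖Xᵀ Z‖². -/
lemma frobNorm_perpProj_mul_sq {X Z : Matrix (Fin n) (Fin p) ℝ} (hX : X ∈ stiefel n p)
    (hZ : Z ∈ stiefel n p) :
    frobNorm (Z * Zᵀ - X * Xᵀ) ^ 2 = 2 * frobNorm (perpProj X * Z) ^ 2 := by
  have h : Zᵀ * Z = 1 := hZ
  rw [frobNorm_sub_projector_sq hX hZ, frobNorm_sq, Matrix.transpose_mul, perpProj_transpose,
    Matrix.mul_assoc Zᵀ, ← Matrix.mul_assoc (perpProj X), perpProj_mul_self hX, perpProj,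
    Matrix.sub_mul, Matrix.mul_sub, Matrix.one_mul, h, Matrix.trace_sub, Matrix.mul_assoc Z,
    Matrix.trace_mul_comm Z, Matrix.mul_assoc Zᵀ]
  simp
  ring

/-- With `B = P_X^⊥ Z`, the gradient `P_X^⊥ Z Zᵀ X` has squared norm `‖B‖² - ‖Bᵀ B‖²`. -/
lemma frobNorm_perpProj_mul_projector_mul_sq {X Z : Matrix (Fin n) (Fin p) ℝ}
    (hX : X ∈ stiefel n p) (hZ : Z ∈ stiefel n p) :
    frobNorm (perpProj X * (Z * Zᵀ) * X) ^ 2 =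
      frobNorm (perpProj X * Z) ^ 2 -
        frobNorm ((perpProj X * Z)ᵀ * (perpProj X * Z)) ^ 2 := by
  have h : Zᵀ * Z = 1 := hZ
  have hN : (perpProj X * Z)ᵀ * (perpProj X * Z) = 1 - Zᵀ * X * (Xᵀ * Z) := by
    rw [Matrix.transpose_mul, perpProj_transpose, Matrix.mul_assoc Zᵀ,
      ← Matrix.mul_assoc (perpProj X), perpProj_mul_self hX, perpProj, Matrix.sub_mul,
      Matrix.mul_sub, Matrix.one_mul, h]
    simp only [Matrix.mul_assoc]
  have h1 : perpProj X * (Z * Zᵀ) * X = perpProj X * Z * (Zᵀ * X) := by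
    simp only [Matrix.mul_assoc]
  rw [h1, frobNorm_sq, Matrix.transpose_mul, Matrix.mul_assoc,
    ← Matrix.mul_assoc (perpProj X * Z)ᵀ, ← Matrix.mul_assoc, Matrix.trace_mul_comm,
    ← Matrix.mul_assoc, frobNorm_sq, frobNorm_sq]
  set N := (perpProj X * Z)ᵀ * (perpProj X * Z) with hNdef
  have hNt : Nᵀ = N := by rw [hNdef, Matrix.transpose_mul, Matrix.transpose_transpose]
  have h2 : Zᵀ * X * (Zᵀ * X)ᵀ = 1 - N := by
    rw [hN, Matrix.transpose_mul, Matrix.transpose_transpose]; abel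
  rw [h2, hNt, Matrix.sub_mul, Matrix.one_mul, Matrix.trace_sub]

lemma frobNorm_perpProj_mul_projector_mul_sq_le {X Z : Matrix (Fin n) (Fin p) ℝ}
    (hX : X ∈ stiefel n p) (hZ : Z ∈ stiefel n p) :
    frobNorm (perpProj X * (Z * Zᵀ) * X) ^ 2 ≤ frobNorm (Z * Zᵀ - X * Xᵀ) ^ 2 / 2 := by
  rw [frobNorm_perpProj_mul_projector_mul_sq hX hZ, frobNorm_perpProj_mul_sq hX hZ]
  nlinarith [sq_nonneg (frobNorm ((perpProj X * Z)ᵀ * (perpProj X * Z)))]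

/-- This is the error bound behind the local analysis. With B = P_X^⊥ Z the hypothesis reads ‖B‖² ≤
1 - σ², so ‖B‖² - ‖Bᵀ B‖² ≥ ‖B‖² (1 - ‖B‖²) ≥ σ² ‖B‖². Some such restriction is needed: the gradient
also vanishes when X is orthogonal to Z. -/
lemma le_frobNorm_perpProj_mul_projector_mul_sq {X Z : Matrix (Fin n) (Fin p) ℝ}
    (hX : X ∈ stiefel n p) (hZ : Z ∈ stiefel n p) {σ : ℝ}
    (h : frobNorm (Z * Zᵀ - X * Xᵀ) ^ 2 ≤ 2 * (1 - σ ^ 2)) :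
    σ ^ 2 * frobNorm (Z * Zᵀ - X * Xᵀ) ^ 2 / 2 ≤ frobNorm (perpProj X * (Z * Zᵀ) * X) ^ 2 := by
  rw [frobNorm_perpProj_mul_projector_mul_sq hX hZ]
  rw [frobNorm_perpProj_mul_sq hX hZ] at h ⊢
  set B := perpProj X * Z
  have h1 : frobNorm (Bᵀ * B) ≤ frobNorm B ^ 2 := by
    refine (frobNorm_mul_le _ _).trans ?_
    rw [frobNorm_transpose, sq]
  have h2 : frobNorm (Bᵀ * B) ^ 2 ≤ (frobNorm B ^ 2) ^ 2 :=
    pow_le_pow_left₀ (frobNorm_nonneg _) h1 2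
  nlinarith [sq_nonneg (frobNorm B)]

lemma abs_entry_le_one_of_mem_stiefel {Z : Matrix (Fin n) (Fin p) ℝ} (hZ : Z ∈ stiefel n p)
    (i : Fin n) (j : Fin p) : |Z i j| ≤ 1 := by
  have h : Zᵀ * Z = 1 := hZ
  have h1 : ∑ k, Z k j * Z k j = 1 := by
    have := congrFun (congrFun h j) j
    simpa [Matrix.mul_apply] using this
  have h2 : Z i j * Z i j ≤ 1 := h1 ▸ Finset.single_le_sum
    (f := fun k => Z k j * Z k j) (fun k _ => mul_self_nonneg _) (Finset.mem_univ i)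
  exact abs_le_one_iff_mul_self_le_one.2 h2

end Stiefel

/-! ### The regularizer -/

section Reg

variable {n p : ℕ} {μ : ℝ}

lemma reg_nonneg (hμ : 0 ≤ μ) (Z : Matrix (Fin n) (Fin p) ℝ) : 0 ≤ reg μ Z :=
  mul_nonneg hμ (Finset.sum_nonneg fun _ _ => Finset.sum_nonneg fun _ _ => abs_nonneg _)

lemma reg_add_le (hμ : 0 ≤ μ) (Y Z : Matrix (Fin n) (Fin p) ℝ) :
    reg μ (Y + Z) ≤ reg μ Y + reg μ Z := by
  rw [reg, reg, reg, ← mul_add]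
  refine mul_le_mul_of_nonneg_left ?_ hμ
  simp only [← Finset.sum_add_distrib]
  exact Finset.sum_le_sum fun i _ => Finset.sum_le_sum fun j _ => abs_add_le _ _

lemma reg_smul {t : ℝ} (ht : 0 ≤ t) (Z : Matrix (Fin n) (Fin p) ℝ) :
    reg μ (t • Z) = t * reg μ Z := by
  simp only [reg, Matrix.smul_apply, smul_eq_mul, abs_mul, abs_of_nonneg ht, ← Finset.mul_sum]
  ring

lemma reg_le_frobNorm (hμ : 0 ≤ μ) (Z : Matrix (Fin n) (Fin p) ℝ) :
    reg μ Z ≤ μ * √((n : ℝ) * p) * frobNorm Z := by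
  rw [reg, mul_assoc]
  refine mul_le_mul_of_nonneg_left ?_ hμ
  simpa using sum_abs_le_frobNorm Z

lemma reg_le_of_mem_stiefel (hμ : 0 ≤ μ) {Z : Matrix (Fin n) (Fin p) ℝ}
    (hZ : Z ∈ stiefel n p) : reg μ Z ≤ μ * n * p := by
  rw [reg, mul_assoc]
  refine mul_le_mul_of_nonneg_left ?_ hμ
  calc ∑ i, ∑ j, |Z i j| ≤ ∑ _i : Fin n, ∑ _j : Fin p, (1 : ℝ) :=
        Finset.sum_le_sum fun i _ => Finset.sum_le_sum fun j _ =>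
          abs_entry_le_one_of_mem_stiefel hZ i j
    _ = n * p := by simp

lemma continuous_reg : Continuous (reg μ : Matrix (Fin n) (Fin p) ℝ → ℝ) := by
  unfold reg
  fun_prop

end Reg

/-! ### The multipliers -/

section Multiplier

variable {n p k : ℕ} (A : Matrix (Fin n) (Fin k) ℝ)

lemma multiplier_eq_projector (X : Matrix (Fin n) (Fin p) ℝ) :
    multiplier A X = -(X * Xᵀ * (A * Aᵀ) * perpProj X + perpProj X * (A * Aᵀ) * (X * Xᵀ)) := by
  rw [multiplier, wMat, Matrix.transpose_neg]
  simp only [Matrix.transpose_mul, Matrix.transpose_transpose, perpProj_transpose,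
    Matrix.mul_neg, Matrix.neg_mul, Matrix.mul_assoc, neg_add]

lemma multiplier_transpose (X : Matrix (Fin n) (Fin p) ℝ) :
    (multiplier A X)ᵀ = multiplier A X := by
  rw [multiplier, Matrix.transpose_add, Matrix.transpose_mul, Matrix.transpose_mul,
    Matrix.transpose_transpose, Matrix.transpose_transpose, add_comm]

variable {X : Matrix (Fin n) (Fin p) ℝ}

lemma multiplier_mul (hX : X ∈ stiefel n p) : multiplier A X * X = wMat A X := by
  have h : Xᵀ * X = 1 := hX
  have h1 : (wMat A X)ᵀ * X = 0 := by
    rw [wMat, Matrix.mul_assoc (perpProj X), Matrix.mul_assoc (perpProj X), Matrix.transpose_neg,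
      Matrix.transpose_mul, perpProj_transpose, Matrix.neg_mul, Matrix.mul_assoc,
      perpProj_mul hX]
    simp
  rw [multiplier, Matrix.add_mul, Matrix.mul_assoc, h1, Matrix.mul_assoc, h]
  simp

lemma perpProj_mul_wMat (hX : X ∈ stiefel n p) : perpProj X * wMat A X = wMat A X := by
  rw [wMat, Matrix.mul_neg]
  simp only [← Matrix.mul_assoc]
  rw [perpProj_mul_self hX]

/-- Λ X = W lies in the range of P_X^⊥, hence is orthogonal to X. This is why the Lagrangian may
pair Λ with Z Zᵀ alone instead of Z Zᵀ - X Xᵀ. -/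
lemma trace_multiplier_mul_projector (hX : X ∈ stiefel n p) :
    (multiplier A X * (X * Xᵀ)).trace = 0 := by
  rw [← Matrix.mul_assoc, multiplier_mul A hX, Matrix.trace_mul_comm, ← perpProj_mul_wMat A hX,
    ← Matrix.mul_assoc, transpose_mul_perpProj hX]
  simp

/-- W is chosen for this cancellation: at the base point only the penalty survives in the residual
of the local subproblem. -/
lemma perpProj_mul_add_multiplier_mul (hX : X ∈ stiefel n p) :
    perpProj X * (A * Aᵀ + multiplier A X) * X = 0 := by
  rw [Matrix.mul_assoc, Matrix.add_mul, multiplier_mul A hX, Matrix.mul_add,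
    perpProj_mul_wMat A hX, wMat]
  simp only [Matrix.mul_assoc]
  simp

lemma frobNorm_mul_transpose_self_le : frobNorm (A * Aᵀ) ≤ frobNorm A ^ 2 := by
  refine (frobNorm_mul_le _ _).trans ?_
  rw [frobNorm_transpose, sq]

lemma frobNorm_multiplier_le (hX : X ∈ stiefel n p) :
    frobNorm (multiplier A X) ≤ 2 * frobNorm A ^ 2 := by
  have hG := frobNorm_mul_transpose_self_le A
  have h2 : frobNorm (perpProj X * (A * Aᵀ) * (X * Xᵀ)) ≤ frobNorm (A * Aᵀ) := by
    rw [← Matrix.mul_assoc, frobNorm_mul_transpose_of_transpose_mul_self_eq_one hX]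
    exact (frobNorm_mul_projector_le hX _).trans (frobNorm_perpProj_mul_le hX _)
  have h1 : frobNorm (X * Xᵀ * (A * Aᵀ) * perpProj X) ≤ frobNorm (A * Aᵀ) := by
    rw [← frobNorm_transpose]
    simpa only [Matrix.transpose_mul, Matrix.transpose_transpose, perpProj_transpose,
      Matrix.mul_assoc] using h2
  rw [multiplier_eq_projector, frobNorm_neg]
  exact (frobNorm_add_le _ _).trans (by linarith)

/-- The multiplier is a Lipschitz continuous function of the projector. -/
lemma frobNorm_multiplier_sub_le {Y : Matrix (Fin n) (Fin p) ℝ} (hX : X ∈ stiefel n p)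
    (hY : Y ∈ stiefel n p) :
    frobNorm (multiplier A X - multiplier A Y) ≤
      2 * specNorm A ^ 2 * frobNorm (X * Xᵀ - Y * Yᵀ) := by
  -- Write P, P' for the two projectors and G = A Aᵀ, so that Λ = -(PG + GP - 2PGP). Splitting PGP -
  -- P'GP' as (P - P')GP + P'G(P - P') collects the terms into reflections 1 - 2P and 1 - 2P'. These
  -- are isometries, which gives the constant 2.
  have h : multiplier A X - multiplier A Y =
      -((X * Xᵀ - Y * Yᵀ) * (A * Aᵀ) * (1 - (2 : ℝ) • (X * Xᵀ)) +
        (1 - (2 : ℝ) • (Y * Yᵀ)) * ((A * Aᵀ) * (X * Xᵀ - Y * Yᵀ))) := by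
    rw [multiplier_eq_projector, multiplier_eq_projector]
    simp only [perpProj]
    generalize X * Xᵀ = P
    generalize Y * Yᵀ = P'
    generalize A * Aᵀ = G
    simp only [Matrix.mul_sub, Matrix.sub_mul, Matrix.mul_one, Matrix.one_mul, Matrix.mul_smul,
      Matrix.smul_mul, Matrix.mul_assoc]
    module
  have hsym : frobNorm ((X * Xᵀ - Y * Yᵀ) * (A * Aᵀ)) =
      frobNorm (A * Aᵀ * (X * Xᵀ - Y * Yᵀ)) := by
    rw [← frobNorm_transpose]
    simp [Matrix.transpose_mul]
  have hR : frobNorm ((X * Xᵀ - Y * Yᵀ) * (A * Aᵀ) * (1 - (2 : ℝ) • (X * Xᵀ))) =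
      frobNorm ((X * Xᵀ - Y * Yᵀ) * (A * Aᵀ)) := by
    have ht : (1 - (2 : ℝ) • (X * Xᵀ))ᵀ = 1 - (2 : ℝ) • (X * Xᵀ) := by
      rw [Matrix.transpose_sub, Matrix.transpose_smul, projector_transpose, Matrix.transpose_one]
    have := frobNorm_mul_transpose_of_transpose_mul_self_eq_one
      (reflection_transpose_mul_self hX) ((X * Xᵀ - Y * Yᵀ) * (A * Aᵀ))
    rwa [ht] at this
  rw [h, frobNorm_neg]
  refine (frobNorm_add_le _ _).trans ?_
  rw [hR, hsym, frobNorm_mul_of_transpose_mul_self_eq_one (reflection_transpose_mul_self hY)]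
  linarith [frobNorm_mul_transpose_mul_le A (X * Xᵀ - Y * Yᵀ)]

end Multiplier

/-! ### The retraction onto the Stiefel manifold -/

section Retraction

variable {n p : ℕ}

lemma IsStiefelProj.mem_stiefel {C Y : Matrix (Fin n) (Fin p) ℝ} (h : IsStiefelProj C Y) :
    Y ∈ stiefel n p := by
  obtain ⟨U, s, V, hU, hV, -, -, rfl⟩ := h
  have hU' : Uᵀ * U = 1 := hU
  have hV' : V * Vᵀ = 1 := mul_eq_one_comm.1 hV
  change (U * Vᵀ)ᵀ * (U * Vᵀ) = 1
  rw [Matrix.transpose_mul, Matrix.transpose_transpose, Matrix.mul_assoc, ← Matrix.mul_assoc Uᵀ,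
    hU', Matrix.one_mul, hV']

lemma mul_mem_stiefel {Z : Matrix (Fin n) (Fin p) ℝ} {V : Matrix (Fin p) (Fin p) ℝ}
    (hZ : Z ∈ stiefel n p) (hV : V ∈ stiefel p p) : Z * V ∈ stiefel n p := by
  have hZ' : Zᵀ * Z = 1 := hZ
  have hV' : Vᵀ * V = 1 := hV
  change (Z * V)ᵀ * (Z * V) = 1
  rw [Matrix.transpose_mul, Matrix.mul_assoc, ← Matrix.mul_assoc Zᵀ, hZ', Matrix.one_mul, hV']

lemma sum_col_sq_of_mem_stiefel {Z : Matrix (Fin n) (Fin p) ℝ} (hZ : Z ∈ stiefel n p)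
    (j : Fin p) : ∑ i, Z i j ^ 2 = 1 := by
  have h : Zᵀ * Z = 1 := hZ
  have := congrFun (congrFun h j) j
  simpa [Matrix.mul_apply, sq] using this

lemma diag_transpose_mul_le_one {U W : Matrix (Fin n) (Fin p) ℝ} (hU : U ∈ stiefel n p)
    (hW : W ∈ stiefel n p) (j : Fin p) : (Uᵀ * W) j j ≤ 1 := by
  have h : ∑ i, (U i j - W i j) ^ 2 = 2 - 2 * (Uᵀ * W) j j := by
    simp only [sub_sq, Finset.sum_add_distrib, Finset.sum_sub_distrib,
      sum_col_sq_of_mem_stiefel hU, sum_col_sq_of_mem_stiefel hW, mul_assoc, ← Finset.mul_sum,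
      Matrix.mul_apply, Matrix.transpose_apply]
    ring
  have h2 : 0 ≤ ∑ i, (U i j - W i j) ^ 2 := Finset.sum_nonneg fun _ _ => sq_nonneg _
  linarith

lemma transpose_mul_self_of_mem_tangentSpace {Z D : Matrix (Fin n) (Fin p) ℝ}
    (hZ : Z ∈ stiefel n p) (hD : D ∈ tangentSpace Z) : (Z + D)ᵀ * (Z + D) = 1 + Dᵀ * D := by
  have hZ' : Zᵀ * Z = 1 := hZ
  have hD' : Dᵀ * Z + Zᵀ * D = 0 := hD
  rw [Matrix.transpose_add, Matrix.add_mul, Matrix.mul_add, Matrix.mul_add, hZ']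
  calc _ = 1 + Dᵀ * D + (Dᵀ * Z + Zᵀ * D) := by abel
    _ = _ := by rw [hD', add_zero]

/-- The singular values of `Z + D` for a tangent vector `D` at `Z`. -/
lemma singularValue_sq {Z D U : Matrix (Fin n) (Fin p) ℝ} {s : Fin p → ℝ}
    {V : Matrix (Fin p) (Fin p) ℝ} (hZ : Z ∈ stiefel n p) (hD : D ∈ tangentSpace Z)
    (hU : U ∈ stiefel n p) (hV : V ∈ stiefel p p)
    (hC : Z + D = U * Matrix.diagonal s * Vᵀ) (j : Fin p) :
    s j ^ 2 = 1 + ∑ i, (D * V) i j ^ 2 := by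
  have hU' : Uᵀ * U = 1 := hU
  have hV' : Vᵀ * V = 1 := hV
  have h1 : (Z + D) * V = U * Matrix.diagonal s := by
    rw [hC, Matrix.mul_assoc, hV', Matrix.mul_one]
  have h2 : ((Z + D) * V)ᵀ * ((Z + D) * V) = 1 + (D * V)ᵀ * (D * V) := by
    rw [Matrix.transpose_mul, Matrix.mul_assoc, ← Matrix.mul_assoc (Z + D)ᵀ,
      transpose_mul_self_of_mem_tangentSpace hZ hD, Matrix.add_mul, Matrix.mul_add,
      Matrix.one_mul, hV', Matrix.transpose_mul]
    simp only [Matrix.mul_assoc]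
  rw [h1, Matrix.transpose_mul, Matrix.mul_assoc, ← Matrix.mul_assoc Uᵀ, hU', Matrix.one_mul,
    Matrix.diagonal_transpose, Matrix.diagonal_mul_diagonal] at h2
  have := congrFun (congrFun h2 j) j
  simpa [Matrix.mul_apply, sq, -Matrix.transpose_mul] using this

lemma one_le_singularValue {Z D U : Matrix (Fin n) (Fin p) ℝ} {s : Fin p → ℝ}
    {V : Matrix (Fin p) (Fin p) ℝ} (hZ : Z ∈ stiefel n p) (hD : D ∈ tangentSpace Z)
    (hU : U ∈ stiefel n p) (hV : V ∈ stiefel p p) (hs : ∀ j, 0 ≤ s j)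
    (hC : Z + D = U * Matrix.diagonal s * Vᵀ) (j : Fin p) : 1 ≤ s j := by
  have h := singularValue_sq hZ hD hU hV hC j
  have h2 : 0 ≤ ∑ i, (D * V) i j ^ 2 := Finset.sum_nonneg fun _ _ => sq_nonneg _
  nlinarith [hs j]

/-- The retraction agrees with the tangent step up to second order. -/
lemma IsStiefelProj.frobNorm_sub_le {Z D Y : Matrix (Fin n) (Fin p) ℝ} (hZ : Z ∈ stiefel n p)
    (hD : D ∈ tangentSpace Z) (h : IsStiefelProj (Z + D) Y) :
    frobNorm (Y - (Z + D)) ≤ frobNorm D ^ 2 / 2 := by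
  obtain ⟨U, s, V, hU, hV, hs, hC, rfl⟩ := h
  have hone := one_le_singularValue hZ hD hU hV hs hC
  have h1 : U * Vᵀ - (Z + D) = U * (Matrix.diagonal (fun j => 1 - s j) * Vᵀ) := by
    have : Matrix.diagonal (fun j => 1 - s j) = 1 - Matrix.diagonal s := by
      rw [← Matrix.diagonal_one, Matrix.diagonal_sub]
    rw [hC, this, Matrix.sub_mul, Matrix.mul_sub, Matrix.one_mul, Matrix.mul_assoc]
  have hV2 : (Vᵀ)ᵀ * Vᵀ = 1 := by rw [Matrix.transpose_transpose]; exact mul_eq_one_comm.1 hV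
  have h2 : frobNorm (D * V) = frobNorm D := by
    have := frobNorm_mul_transpose_of_transpose_mul_self_eq_one hV2 D
    rwa [Matrix.transpose_transpose] at this
  rw [h1, frobNorm_mul_of_transpose_mul_self_eq_one hU,
    frobNorm_mul_transpose_of_transpose_mul_self_eq_one hV]
  have h3 : frobNorm D ^ 2 = ∑ j, (s j ^ 2 - 1) := by
    rw [← h2, frobNorm_sq_eq_sum, Finset.sum_comm]
    refine Finset.sum_congr rfl fun j _ => ?_
    rw [singularValue_sq hZ hD hU hV hC j]
    ring
  -- All s j ≥ 1, so the ℓ² norm is at most the ℓ¹ norm; afterwards s - 1 ≤ (s² - 1)/2.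
  have h4 : frobNorm (Matrix.diagonal fun j => 1 - s j) ≤ ∑ j, (s j - 1) := by
    refine le_of_abs_le (abs_le_of_sq_le_sq ?_ (Finset.sum_nonneg fun j _ => by linarith [hone j]))
    have h5 : frobNorm (Matrix.diagonal fun j => 1 - s j) ^ 2 = ∑ j, (s j - 1) ^ 2 := by
      rw [frobNorm_sq_eq_sum]
      refine Finset.sum_congr rfl fun j _ => ?_
      rw [Finset.sum_eq_single j (fun k _ hk => by simp [Matrix.diagonal_apply_ne' _ hk])
        (by simp), Matrix.diagonal_apply_eq]
      ring
    rw [h5]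
    exact Finset.sum_sq_le_sq_sum_of_nonneg fun j _ => by linarith [hone j]
  refine h4.trans ?_
  rw [h3, Finset.sum_div]
  refine Finset.sum_le_sum fun j _ => ?_
  nlinarith [sq_nonneg (s j - 1)]

/-- The retraction does not move farther than the tangent step. -/
lemma IsStiefelProj.frobNorm_sub_left_le {Z D Y : Matrix (Fin n) (Fin p) ℝ}
    (hZ : Z ∈ stiefel n p) (hD : D ∈ tangentSpace Z) (h : IsStiefelProj (Z + D) Y) :
    frobNorm (Y - Z) ≤ frobNorm D := by
  obtain ⟨U, s, V, hU, hV, hs, hC, rfl⟩ := h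
  have hone := one_le_singularValue hZ hD hU hV hs hC
  have hU' : Uᵀ * U = 1 := hU
  have hV' : Vᵀ * V = 1 := hV
  have h1 : (Z + D) - U * Vᵀ = U * (Matrix.diagonal (fun j => s j - 1) * Vᵀ) := by
    have : Matrix.diagonal (fun j => s j - 1) = Matrix.diagonal s - 1 := by
      rw [← Matrix.diagonal_one, Matrix.diagonal_sub]
    rw [hC, this, Matrix.sub_mul, Matrix.mul_sub, Matrix.one_mul, Matrix.mul_assoc]
  -- D is the sum of the residual Z + D - Y and of Y - Z. Once their inner product is seen to be
  -- nonnegative, ‖Y - Z‖ ≤ ‖D‖ follows by expanding the square.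
  have h2 : (((Z + D) - U * Vᵀ)ᵀ * (U * Vᵀ - Z)).trace =
      ∑ j, (s j - 1) * (1 - (Uᵀ * (Z * V)) j j) := by
    rw [h1, Matrix.transpose_mul, Matrix.transpose_mul, Matrix.transpose_transpose,
      Matrix.diagonal_transpose, Matrix.mul_assoc, Matrix.mul_assoc, Matrix.trace_mul_comm,
      Matrix.mul_assoc, Matrix.mul_assoc, Matrix.sub_mul, Matrix.mul_sub, Matrix.mul_assoc U, hV',
      Matrix.mul_one, hU']
    simp [Matrix.trace, Matrix.diagonal_mul]
  have h3 : 0 ≤ (((Z + D) - U * Vᵀ)ᵀ * (U * Vᵀ - Z)).trace := by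
    rw [h2]
    refine Finset.sum_nonneg fun j _ => mul_nonneg (by linarith [hone j]) ?_
    linarith [diag_transpose_mul_le_one hU (mul_mem_stiefel hZ hV) j]
  have h4 := frobNorm_add_sq ((Z + D) - U * Vᵀ) (U * Vᵀ - Z)
  have h5 : (Z + D) - U * Vᵀ + (U * Vᵀ - Z) = D := by abel
  rw [h5] at h4
  refine le_of_abs_le (abs_le_of_sq_le_sq ?_ (frobNorm_nonneg _))
  nlinarith [sq_nonneg (frobNorm ((Z + D) - U * Vᵀ))]

end Retraction

/-! ### The proximal step -/

section Prox

variable {n p : ℕ} {μ η : ℝ}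

lemma smul_mem_tangentSpace {Z D : Matrix (Fin n) (Fin p) ℝ} (hD : D ∈ tangentSpace Z) (t : ℝ) :
    t • D ∈ tangentSpace Z := by
  have hD' : Dᵀ * Z + Zᵀ * D = 0 := hD
  change (t • D)ᵀ * Z + Zᵀ * (t • D) = 0
  rw [Matrix.transpose_smul, Matrix.smul_mul, Matrix.mul_smul, ← smul_add, hD', smul_zero]

/-- The decrease of the linearized objective along the proximal step, by strong convexity. -/
lemma proxObjective_decrease (hμ : 0 ≤ μ) (hη : 0 < η) {Q : Matrix (Fin n) (Fin n) ℝ}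
    {Z D : Matrix (Fin n) (Fin p) ℝ} (hD : D ∈ tangentSpace Z)
    (hmin : IsMinOn (proxObjective μ η Q Z) (tangentSpace Z) D) :
    matInner (Q * Z) D + 1 / η * frobNorm D ^ 2 + reg μ (Z + D) ≤ reg μ Z := by
  -- Comparing D with t D and dividing by 1 - t leaves the factor 1 + t; letting t → 1 upgrades
  -- 1/(2η) to 1/η.
  have key : ∀ t ∈ Set.Ioo (0 : ℝ) 1, matInner (Q * Z) D + reg μ (Z + D) - reg μ Z +
      (1 + t) * (1 / (2 * η) * frobNorm D ^ 2) ≤ 0 := by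
    intro t ht
    have h := isMinOn_iff.1 hmin (t • D) (smul_mem_tangentSpace hD t)
    have h1 : reg μ (Z + t • D) ≤ (1 - t) * reg μ Z + t * reg μ (Z + D) := by
      have h2 : Z + t • D = (1 - t) • Z + t • (Z + D) := by module
      rw [h2, ← reg_smul (by linarith [ht.2]), ← reg_smul ht.1.le]
      exact reg_add_le hμ _ _
    have h3 : matInner (Q * Z) (t • D) = t * matInner (Q * Z) D := by
      simp [matInner]
    have h4 : frobNorm (t • D) ^ 2 = t ^ 2 * frobNorm D ^ 2 := by
      rw [frobNorm_smul, mul_pow, sq_abs]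
    rw [proxObjective, proxObjective, h3, h4] at h
    have h5 : (1 - t) * (matInner (Q * Z) D + reg μ (Z + D) - reg μ Z +
        (1 + t) * (1 / (2 * η) * frobNorm D ^ 2)) ≤ 0 := by
      nlinarith
    have h6 : 0 < 1 - t := by linarith [ht.2]
    exact nonpos_of_mul_nonpos_right h5 h6
  have hlim : Tendsto (fun t : ℝ => matInner (Q * Z) D + reg μ (Z + D) - reg μ Z +
      (1 + t) * (1 / (2 * η) * frobNorm D ^ 2)) (𝓝[<] 1)
      (𝓝 (matInner (Q * Z) D + reg μ (Z + D) - reg μ Z +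
        (1 + 1) * (1 / (2 * η) * frobNorm D ^ 2))) := by
    refine Tendsto.mono_left (Continuous.tendsto ?_ 1) nhdsWithin_le_nhds
    fun_prop
  have h := le_of_tendsto hlim (eventually_of_mem (Ioo_mem_nhdsLT one_pos) key)
  have h7 : (1 + 1) * (1 / (2 * η) * frobNorm D ^ 2) = 1 / η * frobNorm D ^ 2 := by
    field_simp
    ring
  rw [h7] at h
  linarith

lemma matInner_mul_self_sub {Q : Matrix (Fin n) (Fin n) ℝ} (hQ : Qᵀ = Q)
    (Y Z : Matrix (Fin n) (Fin p) ℝ) :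
    matInner (Q * Y) Y = matInner (Q * Z) Z + 2 * matInner (Q * Z) (Y - Z) +
      matInner (Q * (Y - Z)) (Y - Z) := by
  have h : (Yᵀ * (Q * Z)).trace = (Zᵀ * (Q * Y)).trace := by
    rw [← Matrix.trace_transpose, Matrix.transpose_mul, Matrix.transpose_mul, hQ,
      Matrix.transpose_transpose, Matrix.mul_assoc]
  simp only [matInner, Matrix.transpose_mul, hQ, Matrix.mul_sub, Matrix.sub_mul,
    Matrix.transpose_sub, Matrix.trace_sub, Matrix.mul_assoc, h]
  ring

/-- The objective of the global subproblem decreases along a retracted proximal step. -/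
lemma retraction_decrease (hμ : 0 ≤ μ) (hη : 0 < η) {Q : Matrix (Fin n) (Fin n) ℝ} (hQ : Qᵀ = Q)
    {Z D Y : Matrix (Fin n) (Fin p) ℝ} (hZ : Z ∈ stiefel n p) (hD : D ∈ tangentSpace Z)
    (hmin : IsMinOn (proxObjective μ η Q Z) (tangentSpace Z) D) (hY : IsStiefelProj (Z + D) Y)
    {M : ℝ} (hM : μ * √((n : ℝ) * p) / 2 + frobNorm Q ≤ M) (hηM : 2 * M ≤ 1 / η) :
    1 / 2 * matInner (Q * Y) Y + reg μ Y + M * frobNorm D ^ 2 ≤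
      1 / 2 * matInner (Q * Z) Z + reg μ Z := by
  have h1 := proxObjective_decrease hμ hη hD hmin
  have h2 := hY.frobNorm_sub_le hZ hD
  have h3 := hY.frobNorm_sub_left_le hZ hD
  have h4 : reg μ Y ≤ reg μ (Z + D) + μ * √((n : ℝ) * p) * (frobNorm D ^ 2 / 2) := by
    have h5 : Y = Z + D + (Y - (Z + D)) := by abel
    calc reg μ Y ≤ reg μ (Z + D) + reg μ (Y - (Z + D)) := by
          conv_lhs => rw [h5]
          exact reg_add_le hμ _ _
      _ ≤ _ := by
          gcongr
          exact (reg_le_frobNorm hμ _).trans (by gcongr)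
  have h6 : matInner (Q * Z) (Y - Z) ≤
      matInner (Q * Z) D + frobNorm Q * (frobNorm D ^ 2 / 2) := by
    have h7 : Y - Z = D + (Y - (Z + D)) := by abel
    have h8 : matInner (Q * Z) (Y - Z) =
        matInner (Q * Z) D + matInner (Q * Z) (Y - (Z + D)) := by
      rw [h7]; simp only [matInner, Matrix.mul_add, Matrix.trace_add]
    rw [h8]
    gcongr
    refine (trace_transpose_mul_le _ _).trans ?_
    exact mul_le_mul (frobNorm_mul_projector_le hZ Q) h2 (frobNorm_nonneg _) (frobNorm_nonneg _)
  have h9 : matInner (Q * (Y - Z)) (Y - Z) ≤ frobNorm Q * frobNorm D ^ 2 := by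
    refine (trace_transpose_mul_le _ _).trans ?_
    have h10 := frobNorm_mul_le Q (Y - Z)
    calc frobNorm (Q * (Y - Z)) * frobNorm (Y - Z)
        ≤ (frobNorm Q * frobNorm D) * frobNorm D :=
          mul_le_mul (h10.trans (mul_le_mul_of_nonneg_left h3 (frobNorm_nonneg _))) h3
            (frobNorm_nonneg _) (mul_nonneg (frobNorm_nonneg _) (frobNorm_nonneg _))
      _ = frobNorm Q * frobNorm D ^ 2 := by ring
  have h11 : (μ * √((n : ℝ) * p) / 2 + frobNorm Q + M) * frobNorm D ^ 2 ≤
      1 / η * frobNorm D ^ 2 :=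
    mul_le_mul_of_nonneg_right (by linarith) (sq_nonneg _)
  rw [matInner_mul_self_sub hQ Y Z]
  linarith

end Prox

/-! ### The local subproblems -/

section Local

variable {n p k : ℕ} (A : Matrix (Fin n) (Fin k) ℝ) {X Y Z : Matrix (Fin n) (Fin p) ℝ}

/-- The contribution of one block to the augmented Lagrangian, with the multiplier `Λ(X)`. -/
noncomputable def blockLagrangian (β : ℝ) (X Z : Matrix (Fin n) (Fin p) ℝ) : ℝ :=
  -(1 / 2) * (A * Aᵀ * (X * Xᵀ)).trace + 1 / 2 * (multiplier A X * (Z * Zᵀ)).trace +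
    β / 4 * frobNorm (Z * Zᵀ - X * Xᵀ) ^ 2

lemma perpProj_mul_hMat_mul (β : ℝ) (hX : X ∈ stiefel n p) :
    perpProj X * hMat A β (multiplier A X) Z * X = β • (perpProj X * (Z * Zᵀ) * X) := by
  rw [hMat, Matrix.mul_add, Matrix.add_mul, perpProj_mul_add_multiplier_mul A hX, zero_add,
    Matrix.mul_smul, Matrix.smul_mul]

lemma frobNorm_perpProj_mul_hMat_mul {β : ℝ} (hβ : 0 ≤ β) (hX : X ∈ stiefel n p) :
    frobNorm (perpProj X * hMat A β (multiplier A X) Z * X) =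
      β * frobNorm (perpProj X * (Z * Zᵀ) * X) := by
  rw [perpProj_mul_hMat_mul A β hX, frobNorm_smul, abs_of_nonneg hβ]

/-- On the Stiefel manifold the trace of Z Zᵀ X Xᵀ is affine in the squared projector distance, so
up to terms independent of X the local objective is the block Lagrangian with frozen multiplier. -/
lemma localObjective_hMat (β : ℝ) (L : Matrix (Fin n) (Fin n) ℝ) (hX : X ∈ stiefel n p)
    (hZ : Z ∈ stiefel n p) :
    localObjective (hMat A β L Z) X =
      -(1 / 2) * ((A * Aᵀ + L) * (X * Xᵀ)).trace +
        β / 4 * frobNorm (Z * Zᵀ - X * Xᵀ) ^ 2 - β * p / 2 := by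
  have h : (Xᵀ * hMat A β L Z * X).trace = (hMat A β L Z * (X * Xᵀ)).trace := by
    rw [Matrix.mul_assoc, Matrix.trace_mul_comm, Matrix.mul_assoc]
  rw [localObjective, h, hMat, Matrix.add_mul _ (β • _), Matrix.trace_add, Matrix.smul_mul,
    Matrix.trace_smul, frobNorm_sub_projector_sq hX hZ, smul_eq_mul]
  ring

/-- The residual is pure penalty, so the error bound turns it into a distance; `hβc` bounds the
denominator by 2β. -/
lemma le_decrease_of_frobNorm_sq_le {β c c' σ : ℝ} (hβ : 0 < β) (hc : 0 < c) (hc' : 0 < c')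
    (hβc : c' * specNorm A ^ 2 ≤ β) (hX : X ∈ stiefel n p) (hZ : Z ∈ stiefel n p)
    (hd : frobNorm (Z * Zᵀ - X * Xᵀ) ^ 2 ≤ 2 * (1 - σ ^ 2)) :
    c * σ ^ 2 * β / 4 * frobNorm (Z * Zᵀ - X * Xᵀ) ^ 2 ≤
      c / (c' * specNorm A ^ 2 + β) *
        frobNorm (perpProj X * hMat A β (multiplier A X) Z * X) ^ 2 := by
  have h := le_frobNorm_perpProj_mul_projector_mul_sq hX hZ hd
  have hpos : 0 < c' * specNorm A ^ 2 + β := by positivity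
  have h1 : c / (2 * β) ≤ c / (c' * specNorm A ^ 2 + β) :=
    div_le_div_of_nonneg_left hc.le hpos (by linarith)
  rw [frobNorm_perpProj_mul_hMat_mul A hβ.le hX, mul_pow]
  calc c * σ ^ 2 * β / 4 * frobNorm (Z * Zᵀ - X * Xᵀ) ^ 2
      = c / (2 * β) * (β ^ 2 * (σ ^ 2 * frobNorm (Z * Zᵀ - X * Xᵀ) ^ 2 / 2)) := by
        field_simp
        ring
    _ ≤ c / (2 * β) * (β ^ 2 * frobNorm (perpProj X * (Z * Zᵀ) * X) ^ 2) := by gcongr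
    _ ≤ _ := by gcongr

/-- The linear part of the local objective varies by at most half of 3‖A‖² · 2√p, and `hβA` makes
this no larger than the guaranteed decrease at the critical radius. Hence the new point cannot leave
the neighbourhood. -/
lemma frobNorm_sq_le_of_decrease {β c σ : ℝ} (hσ : c * σ ^ 2 ≤ 1)
    (hβA : 6 * √(p : ℝ) * frobNorm A ^ 2 ≤ β * (c * σ ^ 2 * (1 - σ ^ 2))) (hβ : 0 < β)
    (hX : X ∈ stiefel n p) (hY : Y ∈ stiefel n p) (hZ : Z ∈ stiefel n p)
    (hd : frobNorm (Z * Zᵀ - X * Xᵀ) ^ 2 ≤ 2 * (1 - σ ^ 2))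
    (hdec : c * σ ^ 2 * β / 4 * frobNorm (Z * Zᵀ - X * Xᵀ) ^ 2 ≤
      localObjective (hMat A β (multiplier A X) Z) X -
        localObjective (hMat A β (multiplier A X) Z) Y) :
    frobNorm (Z * Zᵀ - Y * Yᵀ) ^ 2 ≤ 2 * (1 - σ ^ 2) := by
  rw [localObjective_hMat A β _ hX hZ, localObjective_hMat A β _ hY hZ] at hdec
  have h1 : ((A * Aᵀ + multiplier A X) * (Y * Yᵀ)).trace -
      ((A * Aᵀ + multiplier A X) * (X * Xᵀ)).trace ≤ 6 * √(p : ℝ) * frobNorm A ^ 2 := by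
    rw [← Matrix.trace_sub, ← Matrix.mul_sub]
    have h2 : (A * Aᵀ + multiplier A X)ᵀ = A * Aᵀ + multiplier A X := by
      rw [Matrix.transpose_add, multiplier_transpose, projector_transpose]
    have h3 := trace_transpose_mul_le (A * Aᵀ + multiplier A X) (Y * Yᵀ - X * Xᵀ)
    rw [h2] at h3
    refine h3.trans ?_
    have h4 : frobNorm (A * Aᵀ + multiplier A X) ≤ 3 * frobNorm A ^ 2 := by
      refine (frobNorm_add_le _ _).trans ?_
      linarith [frobNorm_mul_transpose_self_le A, frobNorm_multiplier_le A hX]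
    calc _ ≤ 3 * frobNorm A ^ 2 * (2 * √(p : ℝ)) :=
          mul_le_mul h4 (frobNorm_sub_projector_le hX hY) (frobNorm_nonneg _) (by positivity)
      _ = _ := by ring
  have h5 : (1 - c * σ ^ 2) * frobNorm (Z * Zᵀ - X * Xᵀ) ^ 2 ≤
      (1 - c * σ ^ 2) * (2 * (1 - σ ^ 2)) := mul_le_mul_of_nonneg_left hd (by linarith)
  have h6 : β * ((1 - c * σ ^ 2) * frobNorm (Z * Zᵀ - X * Xᵀ) ^ 2) ≤
      β * ((1 - c * σ ^ 2) * (2 * (1 - σ ^ 2))) := mul_le_mul_of_nonneg_left h5 hβ.le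
  refine le_of_mul_le_mul_left ?_ hβ
  linarith

/-- An approximately stationary point of the local subproblem is closer to `Z` than the starting
point. -/
lemma frobNorm_sub_projector_contraction {β δ σ t : ℝ} (hβ : 0 < β) (hδ : 0 ≤ δ) (hσ : 0 < σ)
    (ht : 0 < t) (hβσ : 4 * √2 * specNorm A ^ 2 ≤ β * σ)
    (hβt : 4 * (2 * t + √2) * specNorm A ^ 2 ≤ β * (σ - 2 * t * δ))
    (hX : X ∈ stiefel n p) (hY : Y ∈ stiefel n p) (hZ : Z ∈ stiefel n p)
    (hd : frobNorm (Z * Zᵀ - Y * Yᵀ) ^ 2 ≤ 2 * (1 - σ ^ 2))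
    (hkkt : frobNorm (perpProj Y * hMat A β (multiplier A X) Z * Y) ≤
      δ * frobNorm (perpProj X * hMat A β (multiplier A X) Z * X)) :
    √2 * t * frobNorm (Z * Zᵀ - Y * Yᵀ) ≤ frobNorm (Z * Zᵀ - X * Xᵀ) := by
  set a := specNorm A ^ 2
  have ha : 0 ≤ a := sq_nonneg _
  set e := frobNorm (Z * Zᵀ - X * Xᵀ) with he
  set f := frobNorm (Z * Zᵀ - Y * Yᵀ) with hf
  have he0 : 0 ≤ e := frobNorm_nonneg _
  have hf0 : 0 ≤ f := frobNorm_nonneg _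
  have hw : √2 * √2 = 2 := Real.mul_self_sqrt (by norm_num)
  have hw0 : 0 < √2 := Real.sqrt_pos.2 (by norm_num)
  have hw2 : √2 ≤ 2 := by nlinarith
  have hgX : √2 * frobNorm (perpProj X * (Z * Zᵀ) * X) ≤ e := by
    refine le_of_abs_le (abs_le_of_sq_le_sq ?_ he0)
    have := frobNorm_perpProj_mul_projector_mul_sq_le hX hZ
    rw [← he] at this
    rw [mul_pow, sq √2, hw]
    linarith
  have hgY : σ * f ≤ √2 * frobNorm (perpProj Y * (Z * Zᵀ) * Y) := by
    refine le_of_abs_le (abs_le_of_sq_le_sq ?_ (mul_nonneg hw0.le (frobNorm_nonneg _)))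
    have := le_frobNorm_perpProj_mul_projector_mul_sq hY hZ hd
    rw [← hf] at this
    rw [mul_pow, mul_pow, sq √2, hw]
    linarith
  have hXY : frobNorm (X * Xᵀ - Y * Yᵀ) ≤ e + f := by
    have := frobNorm_sub_le_add (X * Xᵀ) (Z * Zᵀ) (Y * Yᵀ)
    rwa [frobNorm_sub_comm (X * Xᵀ) (Z * Zᵀ)] at this
  -- Replacing Λ(X) by Λ(Y) makes the residual at Y pure penalty, at the price of the Lipschitz
  -- bound.
  have hgrad : β * frobNorm (perpProj Y * (Z * Zᵀ) * Y) ≤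
      frobNorm (perpProj Y * hMat A β (multiplier A X) Z * Y) + 2 * a * (e + f) := by
    rw [← frobNorm_perpProj_mul_hMat_mul A hβ.le hY]
    have h1 : perpProj Y * hMat A β (multiplier A Y) Z * Y =
        perpProj Y * hMat A β (multiplier A X) Z * Y -
          perpProj Y * ((multiplier A X - multiplier A Y) * Y) := by
      simp only [hMat, Matrix.mul_add, Matrix.add_mul, Matrix.mul_sub, Matrix.sub_mul,
        Matrix.mul_assoc]
      abel
    rw [h1]
    refine (frobNorm_sub_le _ _).trans (add_le_add le_rfl ?_)
    refine (frobNorm_perpProj_mul_le hY _).trans ((frobNorm_mul_projector_le hY _).trans ?_)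
    refine (frobNorm_multiplier_sub_le A hX hY).trans ?_
    exact mul_le_mul_of_nonneg_left hXY (by positivity)
  rw [frobNorm_perpProj_mul_hMat_mul A hβ.le hX] at hkkt
  have h2 : β * (σ * f) ≤ δ * β * e + 2 * √2 * a * (e + f) := by
    have h3 := mul_le_mul_of_nonneg_left hgY hβ.le
    have h4 := mul_le_mul_of_nonneg_left (hgrad.trans (add_le_add_left hkkt _)) hw0.le
    have h5 := mul_le_mul_of_nonneg_left hgX (mul_nonneg hδ hβ.le)
    linarith
  have h6 : (β * σ - 2 * √2 * a) * f ≤ (δ * β + 2 * √2 * a) * e := by linarith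
  have h7 : 0 < β * σ - 2 * √2 * a := by linarith [mul_pos hβ hσ]
  -- The bound `hβt` is used here, with √2 rounded up to 2 in the δ term.
  have h8 : √2 * t * (δ * β + 2 * √2 * a) ≤ β * σ - 2 * √2 * a := by
    have h9 : √2 * t * (δ * β + 2 * √2 * a) = √2 * (t * δ * β) + 4 * (t * a) := by
      linear_combination 2 * t * a * hw
    have h10 : √2 * (t * δ * β) ≤ 2 * (t * δ * β) :=
      mul_le_mul_of_nonneg_right hw2 (by positivity)
    have h11 : 0 ≤ t * a := by positivity
    have h12 : 0 ≤ √2 * a := by positivity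
    linarith
  refine le_of_mul_le_mul_left ?_ h7
  calc (β * σ - 2 * √2 * a) * (√2 * t * f) = √2 * t * ((β * σ - 2 * √2 * a) * f) := by ring
    _ ≤ √2 * t * ((δ * β + 2 * √2 * a) * e) := by gcongr
    _ = √2 * t * (δ * β + 2 * √2 * a) * e := by ring
    _ ≤ (β * σ - 2 * √2 * a) * e := by gcongr

/-- The decrease of the Lagrangian in a local step together with the update of the multiplier. -/
lemma blockLagrangian_decrease {β c σ t : ℝ} (ht : 0 < t)
    (hβt : 4 * (√2 * t + 1) * specNorm A ^ 2 ≤ β * (c * σ ^ 2 * t ^ 2))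
    (hX : X ∈ stiefel n p) (hY : Y ∈ stiefel n p) (hZ : Z ∈ stiefel n p)
    (hcontr : √2 * t * frobNorm (Z * Zᵀ - Y * Yᵀ) ≤ frobNorm (Z * Zᵀ - X * Xᵀ))
    (hdec : c * σ ^ 2 * β / 4 * frobNorm (Z * Zᵀ - X * Xᵀ) ^ 2 ≤
      localObjective (hMat A β (multiplier A X) Z) X -
        localObjective (hMat A β (multiplier A X) Z) Y) :
    blockLagrangian A β Y Z + c * σ ^ 2 * β / 8 * frobNorm (Z * Zᵀ - X * Xᵀ) ^ 2 ≤
      blockLagrangian A β X Z := by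
  rw [localObjective_hMat A β _ hX hZ, localObjective_hMat A β _ hY hZ, Matrix.add_mul,
    Matrix.add_mul, Matrix.trace_add, Matrix.trace_add, trace_multiplier_mul_projector A hX] at hdec
  set e := frobNorm (Z * Zᵀ - X * Xᵀ) with he
  set f := frobNorm (Z * Zᵀ - Y * Yᵀ) with hf
  set a := specNorm A ^ 2
  have ha : 0 ≤ a := sq_nonneg _
  have he0 : 0 ≤ e := frobNorm_nonneg _
  have hf0 : 0 ≤ f := frobNorm_nonneg _
  have hw : √2 * √2 = 2 := Real.mul_self_sqrt (by norm_num)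
  have hw0 : 0 < √2 := Real.sqrt_pos.2 (by norm_num)
  -- Besides the change of the local objective, the Lagrangian changes by half of this trace,
  -- because each multiplier is orthogonal to its own projector.
  have h1 : ((multiplier A Y - multiplier A X) * (Z * Zᵀ - Y * Yᵀ)).trace ≤
      2 * a * (e + f) * f := by
    have h2 := trace_transpose_mul_le (multiplier A Y - multiplier A X) (Z * Zᵀ - Y * Yᵀ)
    rw [Matrix.transpose_sub, multiplier_transpose, multiplier_transpose] at h2
    refine h2.trans (mul_le_mul_of_nonneg_right ?_ hf0)
    refine (frobNorm_multiplier_sub_le A hY hX).trans ?_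
    refine mul_le_mul_of_nonneg_left ?_ (by positivity)
    have := frobNorm_sub_le_add (Y * Yᵀ) (Z * Zᵀ) (X * Xᵀ)
    rw [frobNorm_sub_comm (Y * Yᵀ) (Z * Zᵀ)] at this
    linarith
  rw [Matrix.sub_mul, Matrix.mul_sub, Matrix.mul_sub, Matrix.trace_sub, Matrix.trace_sub,
    Matrix.trace_sub, trace_multiplier_mul_projector A hY] at h1
  -- The multiplier update consumes at most half of the decrease in `hdec`. The factor 2t² is
  -- inserted so that the contraction bound can replace √2 t f by e.
  have h3 : a * (e + f) * f ≤ c * σ ^ 2 * β / 8 * e ^ 2 := by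
    have ht2 : 0 < 2 * t ^ 2 := by positivity
    refine le_of_mul_le_mul_left ?_ ht2
    have h4 : 2 * t ^ 2 * (a * (e + f) * f) =
        a * (√2 * t * e + √2 * t * f) * (√2 * t * f) := by
      linear_combination (-(t ^ 2 * (a * (e + f) * f))) * hw
    have h5 : a * (√2 * t * e + √2 * t * f) * (√2 * t * f) ≤ a * (√2 * t * e + e) * e := by
      gcongr
    have h6 := mul_le_mul_of_nonneg_right hβt (sq_nonneg e)
    rw [h4]
    refine h5.trans ?_
    linarith
  rw [blockLagrangian, blockLagrangian, ← he, ← hf]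
  linarith

lemma abs_blockLagrangian_le {β : ℝ} (hβ : 0 ≤ β) (hX : X ∈ stiefel n p) (hZ : Z ∈ stiefel n p) :
    |blockLagrangian A β X Z| ≤ 3 / 2 * frobNorm A ^ 2 * √(p : ℝ) + β * p := by
  have h1 : |(A * Aᵀ * (X * Xᵀ)).trace| ≤ frobNorm A ^ 2 * √(p : ℝ) := by
    have := abs_trace_transpose_mul_le (A * Aᵀ) (X * Xᵀ)
    rw [projector_transpose, frobNorm_mul_transpose_self_of_mem_stiefel hX] at this
    exact this.trans
      (mul_le_mul_of_nonneg_right (frobNorm_mul_transpose_self_le A) (Real.sqrt_nonneg _))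
  have h2 : |(multiplier A X * (Z * Zᵀ)).trace| ≤ 2 * frobNorm A ^ 2 * √(p : ℝ) := by
    have := abs_trace_transpose_mul_le (multiplier A X) (Z * Zᵀ)
    rw [multiplier_transpose, frobNorm_mul_transpose_self_of_mem_stiefel hZ] at this
    exact this.trans
      (mul_le_mul_of_nonneg_right (frobNorm_multiplier_le A hX) (Real.sqrt_nonneg _))
  have h3 : frobNorm (Z * Zᵀ - X * Xᵀ) ^ 2 ≤ 4 * p := by
    have := pow_le_pow_left₀ (frobNorm_nonneg _) (frobNorm_sub_projector_le hX hZ) 2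
    rw [mul_pow, Real.sq_sqrt (Nat.cast_nonneg _)] at this
    linarith
  have h4 : β / 4 * frobNorm (Z * Zᵀ - X * Xᵀ) ^ 2 ≤ β * p := by
    have := mul_le_mul_of_nonneg_left h3 (by positivity : 0 ≤ β / 4)
    linarith
  have h5 : 0 ≤ β / 4 * frobNorm (Z * Zᵀ - X * Xᵀ) ^ 2 := by positivity
  rw [abs_le] at h1 h2
  rw [blockLagrangian, abs_le]
  constructor <;> linarith [h1.1, h1.2, h2.1, h2.2]

end Local

/-! ### First-order stationarity -/

section Tangent

variable {n p : ℕ}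

lemma tangentProj_mem_tangentSpace {Z : Matrix (Fin n) (Fin p) ℝ} (hZ : Z ∈ stiefel n p)
    (M : Matrix (Fin n) (Fin p) ℝ) : tangentProj Z M ∈ tangentSpace Z := by
  have h : Zᵀ * Z = 1 := hZ
  have h1 : Zᵀ * tangentProj Z M = (1 / 2 : ℝ) • (Zᵀ * M - Mᵀ * Z) := by
    rw [tangentProj, Matrix.mul_add, ← Matrix.mul_assoc, transpose_mul_perpProj hZ,
      Matrix.mul_smul, ← Matrix.mul_assoc, h, Matrix.zero_mul, Matrix.one_mul, zero_add]
  have h2 : (tangentProj Z M)ᵀ * Z = (1 / 2 : ℝ) • (Mᵀ * Z - Zᵀ * M) := by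
    rw [← Matrix.transpose_transpose Z, ← Matrix.transpose_mul, Matrix.transpose_transpose, h1]
    simp
  change (tangentProj Z M)ᵀ * Z + Zᵀ * tangentProj Z M = 0
  rw [h1, h2]
  module

lemma tangentProj_add (Z M N : Matrix (Fin n) (Fin p) ℝ) :
    tangentProj Z (M + N) = tangentProj Z M + tangentProj Z N := by
  simp only [tangentProj, Matrix.mul_add, Matrix.transpose_add, Matrix.add_mul, Matrix.mul_sub]
  module

lemma tangentProj_mul_eq_zero {Z : Matrix (Fin n) (Fin p) ℝ} (hZ : Z ∈ stiefel n p)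
    {S : Matrix (Fin p) (Fin p) ℝ} (hS : Sᵀ = S) : tangentProj Z (Z * S) = 0 := by
  have h : Zᵀ * Z = 1 := hZ
  rw [tangentProj, ← Matrix.mul_assoc, perpProj_mul hZ, ← Matrix.mul_assoc, h,
    Matrix.transpose_mul, hS, Matrix.mul_assoc, h]
  simp

lemma sub_tangentProj {Z : Matrix (Fin n) (Fin p) ℝ} (M : Matrix (Fin n) (Fin p) ℝ) :
    M - tangentProj Z M = Z * ((1 / 2 : ℝ) • (Zᵀ * M + Mᵀ * Z)) := by
  simp only [tangentProj, perpProj, Matrix.sub_mul, Matrix.one_mul, Matrix.mul_smul,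
    Matrix.mul_add, Matrix.mul_sub, Matrix.mul_assoc]
  module

lemma matInner_mul_of_mem_tangentSpace {Z Y : Matrix (Fin n) (Fin p) ℝ}
    (hY : Y ∈ tangentSpace Z) {S : Matrix (Fin p) (Fin p) ℝ} (hS : Sᵀ = S) :
    matInner (Z * S) Y = 0 := by
  have hY' : Yᵀ * Z + Zᵀ * Y = 0 := hY
  have h1 : (S * (Zᵀ * Y)).trace = (S * (Yᵀ * Z)).trace := by
    rw [← Matrix.trace_transpose, Matrix.transpose_mul, Matrix.trace_mul_comm, hS]
    simp
  have h2 : (S * (Yᵀ * Z)).trace + (S * (Zᵀ * Y)).trace = 0 := by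
    rw [← Matrix.trace_add, ← Matrix.mul_add, hY']
    simp
  rw [matInner, Matrix.transpose_mul, hS, Matrix.mul_assoc]
  linarith

/-- A matrix orthogonal to the tangent space has zero tangential projection. -/
lemma tangentProj_eq_zero_of_forall {Z M : Matrix (Fin n) (Fin p) ℝ} (hZ : Z ∈ stiefel n p)
    (h : ∀ Y ∈ tangentSpace Z, matInner M Y = 0) : tangentProj Z M = 0 := by
  set Y := tangentProj Z M with hYdef
  have hY : Y ∈ tangentSpace Z := tangentProj_mem_tangentSpace hZ M
  have hS : ((1 / 2 : ℝ) • (Zᵀ * M + Mᵀ * Z))ᵀ = (1 / 2 : ℝ) • (Zᵀ * M + Mᵀ * Z) := by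
    simp [Matrix.transpose_mul, add_comm]
  have h1 := matInner_mul_of_mem_tangentSpace hY hS
  rw [← sub_tangentProj, ← hYdef] at h1
  have h2 : matInner (M - Y) Y = matInner M Y - frobNorm Y ^ 2 := by
    rw [frobNorm_sq]; simp [matInner, Matrix.sub_mul]
  rw [h2, h Y hY, zero_sub, neg_eq_zero] at h1
  exact frobNorm_eq_zero.1 (pow_eq_zero_iff two_ne_zero |>.1 h1)

end Tangent

/-! ### Directional derivatives and Clarke subgradients of the regularizer -/

section Subgradient

variable {n p : ℕ} {μ : ℝ}

/-- The directional derivative of `t ↦ |x + t h|` at `0` from the right. -/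
noncomputable def absDirDeriv (x h : ℝ) : ℝ := if x = 0 then |h| else SignType.sign x * h

/-- The directional derivative of the regularizer. -/
noncomputable def regDirDeriv (μ : ℝ) (Z H : Matrix (Fin n) (Fin p) ℝ) : ℝ :=
  μ * ∑ i, ∑ j, absDirDeriv (Z i j) (H i j)

lemma absDirDeriv_smul (x h : ℝ) {c : ℝ} (hc : 0 < c) :
    absDirDeriv x (c * h) = c * absDirDeriv x h := by
  unfold absDirDeriv
  split_ifs
  · rw [abs_mul, abs_of_pos hc]
  · ring

lemma absDirDeriv_add_le (x h h' : ℝ) :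
    absDirDeriv x (h + h') ≤ absDirDeriv x h + absDirDeriv x h' := by
  unfold absDirDeriv
  split_ifs
  · exact abs_add_le _ _
  · exact (mul_add _ _ _).le

lemma eventually_abs_add_mul_eq (x h : ℝ) :
    ∀ᶠ t in 𝓝[>] (0 : ℝ), |x + t * h| = |x| + t * absDirDeriv x h := by
  rcases lt_trichotomy x 0 with hx | rfl | hx
  · have hc : ∀ᶠ t in 𝓝 (0 : ℝ), x + t * h < 0 := by
      have : Tendsto (fun t : ℝ => x + t * h) (𝓝 0) (𝓝 (x + 0 * h)) :=
        Continuous.tendsto (by fun_prop) 0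
      exact this.eventually (gt_mem_nhds (by simpa using hx))
    filter_upwards [hc.filter_mono nhdsWithin_le_nhds] with t ht
    rw [abs_of_neg ht, abs_of_neg hx, absDirDeriv, if_neg hx.ne, sign_neg hx]
    simp
    ring
  · filter_upwards [self_mem_nhdsWithin] with t ht
    have ht' : 0 < t := ht
    rw [absDirDeriv, if_pos rfl, zero_add, abs_mul, abs_of_pos ht', abs_zero, zero_add]
  · have hc : ∀ᶠ t in 𝓝 (0 : ℝ), 0 < x + t * h := by
      have : Tendsto (fun t : ℝ => x + t * h) (𝓝 0) (𝓝 (x + 0 * h)) :=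
        Continuous.tendsto (by fun_prop) 0
      exact this.eventually (lt_mem_nhds (by simpa using hx))
    filter_upwards [hc.filter_mono nhdsWithin_le_nhds] with t ht
    rw [abs_of_pos ht, abs_of_pos hx, absDirDeriv, if_neg hx.ne', sign_pos hx]
    simp

lemma regDirDeriv_smul (μ : ℝ) (Z H : Matrix (Fin n) (Fin p) ℝ) {c : ℝ} (hc : 0 < c) :
    regDirDeriv μ Z (c • H) = c * regDirDeriv μ Z H := by
  simp only [regDirDeriv, Matrix.smul_apply, smul_eq_mul, absDirDeriv_smul _ _ hc,
    ← Finset.mul_sum]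
  ring

lemma regDirDeriv_add_le (hμ : 0 ≤ μ) (Z H H' : Matrix (Fin n) (Fin p) ℝ) :
    regDirDeriv μ Z (H + H') ≤ regDirDeriv μ Z H + regDirDeriv μ Z H' := by
  rw [regDirDeriv, regDirDeriv, regDirDeriv, ← mul_add]
  refine mul_le_mul_of_nonneg_left ?_ hμ
  simp only [← Finset.sum_add_distrib]
  exact Finset.sum_le_sum fun i _ => Finset.sum_le_sum fun j _ => absDirDeriv_add_le _ _ _

lemma eventually_reg_add_smul_eq (μ : ℝ) (Z H : Matrix (Fin n) (Fin p) ℝ) :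
    ∀ᶠ t in 𝓝[>] (0 : ℝ), reg μ (Z + t • H) = reg μ Z + t * regDirDeriv μ Z H := by
  have h : ∀ᶠ t in 𝓝[>] (0 : ℝ), ∀ i j,
      |Z i j + t * H i j| = |Z i j| + t * absDirDeriv (Z i j) (H i j) :=
    eventually_all.2 fun i => eventually_all.2 fun j => eventually_abs_add_mul_eq _ _
  filter_upwards [h] with t ht
  simp only [reg, regDirDeriv, Matrix.add_apply, Matrix.smul_apply, smul_eq_mul, ht,
    Finset.sum_add_distrib, ← Finset.mul_sum]
  ring

lemma reg_neg (Z : Matrix (Fin n) (Fin p) ℝ) : reg μ (-Z) = reg μ Z := by simp [reg]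

lemma abs_reg_difference_quotient_le (hμ : 0 ≤ μ) (Y H : Matrix (Fin n) (Fin p) ℝ) {t : ℝ}
    (ht : 0 < t) : |(reg μ (Y + t • H) - reg μ Y) / t| ≤ reg μ H := by
  rw [abs_div, abs_of_pos ht, div_le_iff₀ ht, mul_comm, ← reg_smul ht.le, abs_le]
  have h1 := reg_add_le hμ Y (t • H)
  have h2 := reg_add_le hμ (Y + t • H) (-(t • H))
  rw [reg_neg, add_neg_cancel_right] at h2
  constructor <;> linarith

/-- Freezing the base point at Z restricts the filter, which can only lower the upper limit. The
bound on the quotients is required because `limsup` in ℝ is meaningful only for bounded families.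
Only this inequality is needed, since it makes domination by `regDirDeriv` sufficient for a Clarke
subgradient. -/
lemma regDirDeriv_le_clarkeDeriv (hμ : 0 ≤ μ) (Z H : Matrix (Fin n) (Fin p) ℝ) :
    regDirDeriv μ Z H ≤ clarkeDeriv (reg μ) Z H := by
  set f : Matrix (Fin n) (Fin p) ℝ × ℝ → ℝ :=
    fun q => (reg μ (q.1 + q.2 • H) - reg μ q.1) / q.2 with hf
  have hbound : ∀ᶠ q in 𝓝 Z ×ˢ 𝓝[>] (0 : ℝ), |f q| ≤ reg μ H :=
    (tendsto_snd.eventually self_mem_nhdsWithin).mono fun q hq =>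
      abs_reg_difference_quotient_le hμ q.1 H hq
  have hle : pure Z ×ˢ 𝓝[>] (0 : ℝ) ≤ 𝓝 Z ×ˢ 𝓝[>] (0 : ℝ) :=
    Filter.prod_mono (pure_le_nhds Z) le_rfl
  have hev : f =ᶠ[pure Z ×ˢ 𝓝[>] (0 : ℝ)] fun _ => regDirDeriv μ Z H := by
    rw [Filter.pure_prod]
    refine eventually_map.2 ?_
    filter_upwards [eventually_reg_add_smul_eq μ Z H, self_mem_nhdsWithin] with t ht ht0
    have ht0' : 0 < t := ht0
    simp only [hf, ht]
    field_simp
    ring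
  calc regDirDeriv μ Z H = limsup f (pure Z ×ˢ 𝓝[>] (0 : ℝ)) := by
        rw [limsup_congr hev, limsup_const]
    _ ≤ limsup f (𝓝 Z ×ˢ 𝓝[>] (0 : ℝ)) :=
        limsup_le_limsup_of_le hle
          (IsBoundedUnder.isCoboundedUnder_le ⟨-reg μ H, eventually_map.2
            ((hbound.filter_mono hle).mono fun q hq => neg_le_of_abs_le hq)⟩)
          ⟨reg μ H, eventually_map.2 (hbound.mono fun q hq => le_of_abs_le hq)⟩

/-- A linear functional dominated by the directional derivative of the regularizer on the tangent
space is represented there by a Clarke subgradient. -/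
lemma exists_mem_clarkeSubgradient (hμ : 0 ≤ μ) {Z G : Matrix (Fin n) (Fin p) ℝ}
    (h : ∀ Y ∈ tangentSpace Z, 0 ≤ matInner G Y + regDirDeriv μ Z Y) :
    ∃ R ∈ clarkeSubgradient (reg μ) Z, ∀ Y ∈ tangentSpace Z, matInner (G + R) Y = 0 := by
  let T : Submodule ℝ (Matrix (Fin n) (Fin p) ℝ) :=
    { carrier := tangentSpace Z
      add_mem' := fun {Y Y'} hY hY' => by
        have h1 : Yᵀ * Z + Zᵀ * Y = 0 := hY
        have h2 : Y'ᵀ * Z + Zᵀ * Y' = 0 := hY'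
        change (Y + Y')ᵀ * Z + Zᵀ * (Y + Y') = 0
        rw [Matrix.transpose_add, Matrix.add_mul, Matrix.mul_add, add_add_add_comm, h1, h2,
          add_zero]
      zero_mem' := by change (0 : Matrix (Fin n) (Fin p) ℝ)ᵀ * Z + Zᵀ * 0 = 0; simp
      smul_mem' := fun c Y hY => smul_mem_tangentSpace hY c }
  let ℓ : Matrix (Fin n) (Fin p) ℝ →ₗ[ℝ] ℝ :=
    { toFun := fun Y => -matInner G Y
      map_add' := fun Y Y' => by simp [matInner, Matrix.mul_add]; ring
      map_smul' := fun c Y => by simp [matInner] }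
  -- Hahn–Banach: -⟨G, ·⟩ is dominated on the tangent space by a sublinear function defined on all
  -- matrices. The matrix R below represents the extension.
  obtain ⟨g, hg1, hg2⟩ := exists_extension_of_le_sublinear ⟨T, ℓ.comp T.subtype⟩
    (regDirDeriv μ Z) (fun c hc H => regDirDeriv_smul μ Z H hc)
    (fun H H' => regDirDeriv_add_le hμ Z H H') (fun Y => by
      have := h Y.1 Y.2
      change -matInner G Y.1 ≤ _
      linarith)
  let R : Matrix (Fin n) (Fin p) ℝ := Matrix.of fun i j => g (Matrix.single i j 1)
  have hR : ∀ H, matInner R H = g H := by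
    intro H
    conv_rhs => rw [Matrix.matrix_eq_sum_single H]
    rw [matInner, trace_transpose_mul_eq_sum, map_sum]
    refine Finset.sum_congr rfl fun i _ => ?_
    rw [map_sum]
    refine Finset.sum_congr rfl fun j _ => ?_
    have h1 : Matrix.single i j (H i j) = H i j • Matrix.single i j (1 : ℝ) := by
      simp [Matrix.smul_single]
    rw [h1, map_smul, smul_eq_mul, mul_comm]
    rfl
  refine ⟨R, fun H => (hR H).trans_le ((hg2 H).trans (regDirDeriv_le_clarkeDeriv hμ Z H)), ?_⟩
  intro Y hY
  have h1 : g Y = -matInner G Y := hg1 ⟨Y, hY⟩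
  have h2 : matInner (G + R) Y = matInner G Y + matInner R Y := by
    simp [matInner, Matrix.add_mul]
  rw [h2, hR, h1, add_neg_cancel]

/-- If `0` solves the proximal subproblem at `Z`, then `Q Z` is, up to a normal vector, minus a
subgradient of the regularizer. -/
lemma exists_tangentProj_eq_zero (hμ : 0 ≤ μ) {η : ℝ} {Q : Matrix (Fin n) (Fin n) ℝ}
    {Z : Matrix (Fin n) (Fin p) ℝ} (hZ : Z ∈ stiefel n p)
    (hmin : ∀ Y ∈ tangentSpace Z, proxObjective μ η Q Z 0 ≤ proxObjective μ η Q Z Y) :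
    ∃ R ∈ clarkeSubgradient (reg μ) Z, tangentProj Z (Q * Z + R) = 0 := by
  obtain ⟨R, hR, h⟩ := exists_mem_clarkeSubgradient hμ (Z := Z) (G := Q * Z) fun Y hY => by
    -- Testing with t Y and dividing by t makes the quadratic term vanish as t → 0⁺.
    have hev : ∀ᶠ t in 𝓝[>] (0 : ℝ), 0 ≤ matInner (Q * Z) Y + regDirDeriv μ Z Y +
        t * (1 / (2 * η) * frobNorm Y ^ 2) := by
      filter_upwards [eventually_reg_add_smul_eq μ Z Y, self_mem_nhdsWithin] with t ht ht0
      have ht0' : 0 < t := ht0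
      have h1 := hmin (t • Y) (smul_mem_tangentSpace hY t)
      have h2 : matInner (Q * Z) (t • Y) = t * matInner (Q * Z) Y := by simp [matInner]
      have h3 : matInner (Q * Z) 0 = 0 := by simp [matInner]
      have h4 : frobNorm (0 : Matrix (Fin n) (Fin p) ℝ) = 0 := frobNorm_eq_zero.2 rfl
      rw [proxObjective, proxObjective, h2, h3, h4, ht, frobNorm_smul, mul_pow, sq_abs,
        add_zero] at h1
      have h5 : 0 ≤ t * (matInner (Q * Z) Y + regDirDeriv μ Z Y +
          t * (1 / (2 * η) * frobNorm Y ^ 2)) := by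
        linarith
      exact nonneg_of_mul_nonneg_right h5 ht0'
    have hlim : Tendsto (fun t : ℝ => matInner (Q * Z) Y + regDirDeriv μ Z Y +
        t * (1 / (2 * η) * frobNorm Y ^ 2)) (𝓝[>] 0)
        (𝓝 (matInner (Q * Z) Y + regDirDeriv μ Z Y + 0 * (1 / (2 * η) * frobNorm Y ^ 2))) :=
      Tendsto.mono_left (Continuous.tendsto (by fun_prop) 0) nhdsWithin_le_nhds
    simpa using ge_of_tendsto hlim hev
  exact ⟨R, hR, tangentProj_eq_zero_of_forall hZ h⟩

end Subgradient

/-! ### Accumulation points of the iterates -/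

section Limit

variable {n p : ℕ}

lemma continuous_frobNorm {a b : ℕ} :
    Continuous (frobNorm : Matrix (Fin a) (Fin b) ℝ → ℝ) := by
  have h : (frobNorm : Matrix (Fin a) (Fin b) ℝ → ℝ) = fun M => √((Mᵀ * M).trace) := by
    ext M
    rw [← frobNorm_sq, Real.sqrt_sq (frobNorm_nonneg _)]
  rw [h]
  fun_prop

lemma abs_entry_le_frobNorm {a b : ℕ} (M : Matrix (Fin a) (Fin b) ℝ) (i : Fin a) (j : Fin b) :
    |M i j| ≤ frobNorm M := by
  refine abs_le_of_sq_le_sq ?_ (frobNorm_nonneg _)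
  rw [frobNorm_sq_eq_sum]
  refine (Finset.single_le_sum (f := fun j => M i j ^ 2) (fun _ _ => sq_nonneg _)
    (Finset.mem_univ j)).trans ?_
  exact Finset.single_le_sum (f := fun i => ∑ j, M i j ^ 2)
    (fun _ _ => Finset.sum_nonneg fun _ _ => sq_nonneg _) (Finset.mem_univ i)

lemma tendsto_zero_of_frobNorm_sq {a b : ℕ} {M : ℕ → Matrix (Fin a) (Fin b) ℝ}
    (h : Tendsto (fun k => frobNorm (M k) ^ 2) atTop (𝓝 0)) : Tendsto M atTop (𝓝 0) := by
  have h1 : Tendsto (fun k => frobNorm (M k)) atTop (𝓝 0) := by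
    have := (Real.continuous_sqrt.tendsto 0).comp h
    simpa [Function.comp_def, Real.sqrt_sq (frobNorm_nonneg _)] using this
  refine tendsto_pi_nhds.2 fun i => tendsto_pi_nhds.2 fun j => ?_
  exact squeeze_zero_norm (fun k => abs_entry_le_frobNorm (M k) i j) h1

lemma isClosed_stiefel : IsClosed (stiefel n p) :=
  isClosed_eq (by fun_prop) continuous_const

lemma exists_mapClusterPt_of_mem_stiefel {Z : ℕ → Matrix (Fin n) (Fin p) ℝ}
    (hZ : ∀ k, Z k ∈ stiefel n p) : ∃ Y, MapClusterPt Y atTop Z := by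
  have hK : IsCompact (Set.univ.pi fun _ : Fin n => Set.univ.pi fun _ : Fin p =>
      Set.Icc (-1 : ℝ) 1) :=
    isCompact_univ_pi fun _ => isCompact_univ_pi fun _ => isCompact_Icc
  obtain ⟨Y, -, hY⟩ := hK.exists_mapClusterPt (u := Z) (f := atTop) <|
    tendsto_principal.2 <| Eventually.of_forall fun k i _ j _ =>
      abs_le.1 (abs_entry_le_one_of_mem_stiefel (hZ k) i j)
  exact ⟨Y, hY⟩

lemma tangentProj_of_mem {Z Y : Matrix (Fin n) (Fin p) ℝ} (hY : Y ∈ tangentSpace Z) :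
    tangentProj Z Y = Y := by
  have h : Yᵀ * Z + Zᵀ * Y = 0 := hY
  have h1 := sub_tangentProj (Z := Z) Y
  rw [add_comm (Zᵀ * Y), h, smul_zero, Matrix.mul_zero] at h1
  exact (sub_eq_zero.1 h1).symm

variable {μ η : ℝ}

lemma tendsto_proxObjective {α : Type*} {l : Filter α} {Q : α → Matrix (Fin n) (Fin n) ℝ}
    {Z D : α → Matrix (Fin n) (Fin p) ℝ} {Q₀ : Matrix (Fin n) (Fin n) ℝ}
    {Z₀ D₀ : Matrix (Fin n) (Fin p) ℝ} (hQ : Tendsto Q l (𝓝 Q₀)) (hZ : Tendsto Z l (𝓝 Z₀))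
    (hD : Tendsto D l (𝓝 D₀)) :
    Tendsto (fun k => proxObjective μ η (Q k) (Z k) (D k)) l
      (𝓝 (proxObjective μ η Q₀ Z₀ D₀)) := by
  have hc : Continuous fun q : Matrix (Fin n) (Fin n) ℝ × Matrix (Fin n) (Fin p) ℝ ×
      Matrix (Fin n) (Fin p) ℝ => ((q.1 * q.2.1)ᵀ * q.2.2).trace :=
    ((continuous_fst.matrix_mul continuous_snd.fst).matrix_transpose.matrix_mul
      continuous_snd.snd).matrix_trace
  have h0 : Tendsto (fun k => (Q k, Z k, D k)) l (𝓝 (Q₀, Z₀, D₀)) :=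
    hQ.prodMk_nhds (hZ.prodMk_nhds hD)
  have h1 : Tendsto (fun k => ((Q k * Z k)ᵀ * D k).trace) l (𝓝 ((Q₀ * Z₀)ᵀ * D₀).trace) := by
    simpa only [Function.comp_def] using (hc.tendsto (Q₀, Z₀, D₀)).comp h0
  have h2 : Tendsto (fun k => frobNorm (D k)) l (𝓝 (frobNorm D₀)) :=
    (continuous_frobNorm.tendsto D₀).comp hD
  have h3 : Tendsto (fun k => reg μ (Z k + D k)) l (𝓝 (reg μ (Z₀ + D₀))) :=
    (continuous_reg.tendsto (Z₀ + D₀)).comp (hZ.add hD)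
  simp only [proxObjective, matInner]
  exact (h1.add ((h2.pow 2).const_mul (1 / (2 * η)))).add h3

/-- Proximal subproblems with vanishing solutions have `0` as a solution of the limiting
subproblem. -/
lemma proxObjective_zero_le_of_tendsto {Q : ℕ → Matrix (Fin n) (Fin n) ℝ}
    {Z D : ℕ → Matrix (Fin n) (Fin p) ℝ} {Q₀ : Matrix (Fin n) (Fin n) ℝ}
    {Z₀ : Matrix (Fin n) (Fin p) ℝ} (hQ : Tendsto Q atTop (𝓝 Q₀)) (hZ : Tendsto Z atTop (𝓝 Z₀))
    (hD : Tendsto D atTop (𝓝 0)) (hmem : ∀ k, Z k ∈ stiefel n p)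
    (hmin : ∀ k, IsMinOn (proxObjective μ η (Q k) (Z k)) (tangentSpace (Z k)) (D k))
    {Y : Matrix (Fin n) (Fin p) ℝ} (hY : Y ∈ tangentSpace Z₀) :
    proxObjective μ η Q₀ Z₀ 0 ≤ proxObjective μ η Q₀ Z₀ Y := by
  -- The tangent space moves with k, so the competitor Y is replaced by its projection onto the
  -- current one.
  have hYk : Tendsto (fun k => tangentProj (Z k) Y) atTop (𝓝 Y) := by
    have hc : Continuous fun W : Matrix (Fin n) (Fin p) ℝ => tangentProj W Y := by
      unfold tangentProj perpProj
      fun_prop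
    have := (hc.tendsto Z₀).comp hZ
    rwa [tangentProj_of_mem hY] at this
  exact le_of_tendsto_of_tendsto' (tendsto_proxObjective hQ hZ hD)
    (tendsto_proxObjective hQ hZ hYk) fun k =>
      isMinOn_iff.1 (hmin k) _ (tangentProj_mem_tangentSpace (hmem k) Y)

variable {d : ℕ} {m : Fin d → ℕ} (A : ∀ i, Matrix (Fin n) (Fin (m i)) ℝ)

lemma dataMatrix_mul_transpose : dataMatrix A * (dataMatrix A)ᵀ = ∑ i, A i * (A i)ᵀ := by
  ext a b
  simp [dataMatrix, Matrix.mul_apply, Matrix.sum_apply, Fintype.sum_sigma]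

lemma frobNorm_dataMatrix_sq : frobNorm (dataMatrix A) ^ 2 = ∑ i, frobNorm (A i) ^ 2 := by
  simp only [frobNorm_sq_eq_sum, dataMatrix, Matrix.of_apply, Fintype.sum_sigma]
  exact Finset.sum_comm

/-- At consensus each Λ_i Z is W_i = -A_i A_iᵀ Z + Z Zᵀ A_i A_iᵀ Z, and Z Zᵀ Z = Z. The discrepancy
is therefore Z times a symmetric matrix, which the tangential projection kills. -/
lemma qMat_consensus_mul (β : Fin d → ℝ) {Z : Matrix (Fin n) (Fin p) ℝ} (hZ : Z ∈ stiefel n p) :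
    -(dataMatrix A * (dataMatrix A)ᵀ * Z) =
      qMat β (fun _ => Z) (fun i => multiplier (A i) Z) * Z +
        Z * ((∑ i, β i) • (1 : Matrix (Fin p) (Fin p) ℝ) -
          Zᵀ * (dataMatrix A * (dataMatrix A)ᵀ) * Z) := by
  have h : Zᵀ * Z = 1 := hZ
  have h1 : ∀ i, (multiplier (A i) Z - β i • (Z * Zᵀ)) * Z =
      -(A i * (A i)ᵀ * Z) + Z * Zᵀ * (A i * (A i)ᵀ) * Z - β i • Z := by
    intro i
    rw [Matrix.sub_mul, multiplier_mul (A i) hZ, wMat, perpProj, Matrix.smul_mul,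
      Matrix.mul_assoc Z, h, Matrix.mul_one]
    simp only [Matrix.sub_mul, Matrix.one_mul, Matrix.mul_assoc]
    abel
  rw [qMat, Matrix.sum_mul, Finset.sum_congr rfl fun i _ => h1 i, dataMatrix_mul_transpose]
  simp only [Finset.sum_sub_distrib, Finset.sum_add_distrib, Finset.sum_neg_distrib,
    Matrix.mul_sub, Matrix.mul_smul, Matrix.mul_one, ← Finset.sum_smul, ← Matrix.sum_mul,
    ← Matrix.mul_sum, ← Matrix.mul_assoc Z]
  abel

/-- The multiplier depends on X only through X Xᵀ, so the local variables themselves need not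
converge. -/
lemma tendsto_multiplier {k : ℕ} (B : Matrix (Fin n) (Fin k) ℝ)
    {X : ℕ → Matrix (Fin n) (Fin p) ℝ} {Z : Matrix (Fin n) (Fin p) ℝ}
    (h : Tendsto (fun k => X k * (X k)ᵀ) atTop (𝓝 (Z * Zᵀ))) :
    Tendsto (fun k => multiplier B (X k)) atTop (𝓝 (multiplier B Z)) := by
  simp only [multiplier_eq_projector, perpProj]
  have hc : Continuous fun P : Matrix (Fin n) (Fin n) ℝ =>
      -(P * (B * Bᵀ) * (1 - P) + (1 - P) * (B * Bᵀ) * P) := by fun_prop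
  exact (hc.tendsto _).comp h

/-- Accumulation points are stationary once the steps and the consensus errors vanish. -/
lemma isStationary_of_mapClusterPt (hμ : 0 ≤ μ) {β : Fin d → ℝ}
    {Z D : ℕ → Matrix (Fin n) (Fin p) ℝ} {X : ℕ → Fin d → Matrix (Fin n) (Fin p) ℝ}
    (hZ : ∀ k, Z k ∈ stiefel n p)
    (hmin : ∀ k, IsMinOn (proxObjective μ η
      (qMat β (X k) fun i => multiplier (A i) (X k i)) (Z k)) (tangentSpace (Z k)) (D k))
    (hD : Tendsto (fun k => frobNorm (D k) ^ 2) atTop (𝓝 0))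
    (hX : ∀ i, Tendsto (fun k => frobNorm (Z k * (Z k)ᵀ - X k i * (X k i)ᵀ) ^ 2) atTop (𝓝 0))
    {Y : Matrix (Fin n) (Fin p) ℝ} (hY : MapClusterPt Y atTop Z) : IsStationary A μ Y := by
  have : FirstCountableTopology (Matrix (Fin n) (Fin p) ℝ) :=
    inferInstanceAs (FirstCountableTopology (Fin n → Fin p → ℝ))
  obtain ⟨φ, hφ, hlim⟩ := hY.tendsto_subseq
  have hYmem : Y ∈ stiefel n p :=
    isClosed_stiefel.mem_of_tendsto hlim (Eventually.of_forall fun k => hZ _)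
  have hlim' : Tendsto (fun k => Z (φ k)) atTop (𝓝 Y) := hlim
  have hPZ : Tendsto (fun k => Z (φ k) * (Z (φ k))ᵀ) atTop (𝓝 (Y * Yᵀ)) := by
    have hc : Continuous fun W : Matrix (Fin n) (Fin p) ℝ => W * Wᵀ := by fun_prop
    exact (hc.tendsto Y).comp hlim'
  have hP : ∀ i, Tendsto (fun k => X (φ k) i * (X (φ k) i)ᵀ) atTop (𝓝 (Y * Yᵀ)) := by
    intro i
    have h1 := (tendsto_zero_of_frobNorm_sq (hX i)).comp hφ.tendsto_atTop
    have h2 := hPZ.sub h1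
    simpa [Function.comp_def] using h2
  have hQ : Tendsto (fun k => qMat β (X (φ k)) fun i => multiplier (A i) (X (φ k) i)) atTop
      (𝓝 (qMat β (fun _ => Y) fun i => multiplier (A i) Y)) := by
    unfold qMat
    exact tendsto_finsetSum _ fun i _ =>
      (tendsto_multiplier (A i) (hP i)).sub ((hP i).const_smul (β i))
  have hD' := (tendsto_zero_of_frobNorm_sq hD).comp hφ.tendsto_atTop
  obtain ⟨R, hR, h0⟩ := exists_tangentProj_eq_zero hμ hYmem fun W hW =>
    proxObjective_zero_le_of_tendsto hQ hlim' hD' (fun k => hZ _) (fun k => hmin (φ k)) hW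
  refine ⟨hYmem, R, hR, ?_⟩
  rw [qMat_consensus_mul A β hYmem, add_right_comm, tangentProj_add, h0, zero_add]
  refine tangentProj_mul_eq_zero hYmem ?_
  simp [Matrix.transpose_mul, Matrix.mul_assoc]

end Limit

/-! ### Consequences of the conditions on the parameters -/

section Parameters

variable {n p d : ℕ} {m : Fin d → ℕ} {A : ∀ i, Matrix (Fin n) (Fin (m i)) ℝ} {μ : ℝ}
  {P : Params d}

lemma StepCondition.sqrt_pos (h : StepCondition p A μ P) (hd : 0 < d) : 0 < √(P.ρ * d) := by
  have h1 := h.one_le_ρ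
  have h2 : (0 : ℝ) < d := Nat.cast_pos.2 hd
  exact Real.sqrt_pos.2 (by positivity)

lemma StepCondition.sqrt_sq (h : StepCondition p A μ P) : √(P.ρ * d) ^ 2 = P.ρ * d := by
  have h1 := h.one_le_ρ
  exact Real.sq_sqrt (by positivity)

lemma StepCondition.c_mul_sq_le_one (h : StepCondition p A μ P) (i : Fin d) :
    P.c i * P.σ ^ 2 ≤ 1 := by
  have h1 := Real.sqrt_pos.2 (h.c_pos i)
  have h2 := h.σ_lt i
  rw [lt_div_iff₀ h1] at h2
  have h3 : (P.σ * √(P.c i)) ^ 2 ≤ 1 :=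
    pow_le_one₀ (mul_nonneg h.σ_pos.le h1.le) h2.le
  rw [mul_pow, Real.sq_sqrt (h.c_pos i).le] at h3
  linarith

lemma StepCondition.sub_pos (h : StepCondition p A μ P) (hd : 0 < d) (i : Fin d) :
    0 < P.σ - 2 * √(P.ρ * d) * P.δ i := by
  have h1 := h.δ_lt i
  rw [lt_div_iff₀ (mul_pos two_pos (h.sqrt_pos hd))] at h1
  linarith

lemma StepCondition.one_sub_sq_pos (h : StepCondition p A μ P) : 0 < 1 - P.σ ^ 2 := by
  have h1 : P.σ ^ 2 < 1 := pow_lt_one₀ h.σ_pos.le h.σ_lt_one two_ne_zero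
  linarith

lemma PenaltyCondition.xi_mul_le (h : PenaltyCondition p A μ P) {x : ℝ} {i : Fin d}
    (hx : x ≤ xi P i) : x * specNorm (A i) ^ 2 ≤ P.β i :=
  (mul_le_mul_of_nonneg_right hx (sq_nonneg _)).trans ((le_max_left _ _).trans (h.β_lower i))

lemma PenaltyCondition.div_xi_mul_le (h : PenaltyCondition p A μ P) {x y : ℝ} {i : Fin d}
    (hy : 0 < y) (hx : x / y ≤ xi P i) : x * specNorm (A i) ^ 2 ≤ P.β i * y := by
  have h1 := h.xi_mul_le hx
  rw [div_mul_eq_mul_div, div_le_iff₀ hy] at h1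
  exact h1

lemma PenaltyCondition.c'_mul_le (h : PenaltyCondition p A μ P) (i : Fin d) :
    P.c' i * specNorm (A i) ^ 2 ≤ P.β i :=
  h.xi_mul_le (le_max_left _ _)

lemma PenaltyCondition.multiplier_bound (h : PenaltyCondition p A μ P)
    (hs : StepCondition p A μ P) (i : Fin d) :
    4 * √2 * specNorm (A i) ^ 2 ≤ P.β i * P.σ :=
  h.div_xi_mul_le hs.σ_pos ((le_max_left _ _).trans (le_max_right _ _))

lemma PenaltyCondition.contraction_bound (h : PenaltyCondition p A μ P)
    (hs : StepCondition p A μ P) (hd : 0 < d) (i : Fin d) :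
    4 * (2 * √(P.ρ * d) + √2) * specNorm (A i) ^ 2 ≤
      P.β i * (P.σ - 2 * √(P.ρ * d) * P.δ i) :=
  h.div_xi_mul_le (hs.sub_pos hd i)
    ((le_max_left _ _).trans ((le_max_right _ _).trans (le_max_right _ _)))

lemma PenaltyCondition.ascent_bound (h : PenaltyCondition p A μ P)
    (hs : StepCondition p A μ P) (hd : 0 < d) (i : Fin d) :
    4 * (√2 * √(P.ρ * d) + 1) * specNorm (A i) ^ 2 ≤
      P.β i * (P.c i * P.σ ^ 2 * √(P.ρ * d) ^ 2) := by
  have h1 := hs.c_pos i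
  have h2 := hs.σ_pos
  have h3 := hs.sqrt_pos hd
  refine h.div_xi_mul_le (by positivity) ?_
  rw [hs.sqrt_sq, ← Real.sqrt_mul (by norm_num), ← mul_assoc, ← mul_assoc]
  exact (le_max_right _ _).trans ((le_max_right _ _).trans (le_max_right _ _))

lemma PenaltyCondition.global_bound (h : PenaltyCondition p A μ P)
    (hs : StepCondition p A μ P) (i : Fin d) :
    8 * (μ * n * p + √(p : ℝ) * frobNorm (dataMatrix A) ^ 2) ≤ P.β i * (1 - P.σ ^ 2) := by
  rw [← div_le_iff₀ hs.one_sub_sq_pos]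
  exact (le_max_left _ _).trans ((le_max_right _ _).trans (h.β_lower i))

lemma PenaltyCondition.local_bound (h : PenaltyCondition p A μ P)
    (hs : StepCondition p A μ P) (i : Fin d) :
    6 * √(p : ℝ) * frobNorm (A i) ^ 2 ≤ P.β i * (P.c i * P.σ ^ 2 * (1 - P.σ ^ 2)) := by
  have h1 := hs.c_pos i
  have h2 := hs.σ_pos
  have h3 := hs.one_sub_sq_pos
  rw [← div_le_iff₀ (by positivity)]
  exact (le_max_right _ _).trans ((le_max_right _ _).trans (h.β_lower i))

lemma Mbar_pos (hp : 0 < p) (hd : 0 < d) (hμ : 0 < μ) (h : PenaltyCondition p A μ P) :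
    0 < Mbar p A μ P := by
  have h1 : 0 < √(p : ℝ) := Real.sqrt_pos.2 (Nat.cast_pos.2 hp)
  have h2 : 0 < ∑ i, P.β i :=
    Finset.sum_pos (fun i _ => h.β_pos i) ⟨⟨0, hd⟩, Finset.mem_univ _⟩
  rw [Mbar]
  positivity

lemma StepCondition.two_mul_Mbar_le (h : StepCondition p A μ P) (hM : 0 < Mbar p A μ P) :
    2 * Mbar p A μ P ≤ 1 / P.η := by
  rw [le_div_iff₀ h.η_pos]
  have := h.η_lt
  rw [lt_div_iff₀ (by linarith)] at this
  linarith

end Parameters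

/-! ### The augmented Lagrangian along the iteration -/

section Iteration

variable {n p d : ℕ} {m : Fin d → ℕ} (A : ∀ i, Matrix (Fin n) (Fin (m i)) ℝ)

/-- The augmented Lagrangian, with the multipliers `Λ(X_i)`. -/
noncomputable def lagrangian (μ : ℝ) (β : Fin d → ℝ) (X : Fin d → Matrix (Fin n) (Fin p) ℝ)
    (Z : Matrix (Fin n) (Fin p) ℝ) : ℝ :=
  ∑ i, blockLagrangian (A i) (β i) (X i) Z + reg μ Z

lemma abs_lagrangian_le {μ : ℝ} (hμ : 0 ≤ μ) {β : Fin d → ℝ} (hβ : ∀ i, 0 ≤ β i)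
    {X : Fin d → Matrix (Fin n) (Fin p) ℝ} {Z : Matrix (Fin n) (Fin p) ℝ}
    (hX : ∀ i, X i ∈ stiefel n p) (hZ : Z ∈ stiefel n p) :
    |lagrangian A μ β X Z| ≤
      ∑ i, (3 / 2 * frobNorm (A i) ^ 2 * √(p : ℝ) + β i * p) + μ * n * p := by
  refine (abs_add_le _ _).trans (add_le_add ?_ ?_)
  · exact (Finset.abs_sum_le_sum_abs _ _).trans
      (Finset.sum_le_sum fun i _ => abs_blockLagrangian_le (A i) (hβ i) (hX i) hZ)
  · rw [abs_of_nonneg (reg_nonneg hμ Z)]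
    exact reg_le_of_mem_stiefel hμ hZ

lemma qMat_transpose (β : Fin d → ℝ) (X : Fin d → Matrix (Fin n) (Fin p) ℝ) :
    (qMat β X fun i => multiplier (A i) (X i))ᵀ = qMat β X fun i => multiplier (A i) (X i) := by
  rw [qMat, Matrix.transpose_sum]
  refine Finset.sum_congr rfl fun i _ => ?_
  rw [Matrix.transpose_sub, multiplier_transpose, Matrix.transpose_smul, projector_transpose]

lemma frobNorm_qMat_le {β : Fin d → ℝ} (hβ : ∀ i, 0 ≤ β i)
    {X : Fin d → Matrix (Fin n) (Fin p) ℝ} (hX : ∀ i, X i ∈ stiefel n p) :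
    frobNorm (qMat β X fun i => multiplier (A i) (X i)) ≤
      2 * frobNorm (dataMatrix A) ^ 2 + √(p : ℝ) * ∑ i, β i := by
  refine (frobNorm_sum_le _ _).trans ?_
  rw [frobNorm_dataMatrix_sq, Finset.mul_sum, Finset.mul_sum, ← Finset.sum_add_distrib]
  refine Finset.sum_le_sum fun i _ => (frobNorm_sub_le _ _).trans ?_
  rw [frobNorm_smul, abs_of_nonneg (hβ i), frobNorm_mul_transpose_self_of_mem_stiefel (hX i),
    mul_comm (β i)]
  linarith [frobNorm_multiplier_le (A i) (hX i)]

/-- With the local variables fixed, the Lagrangian is a quadratic form in Z plus the regularizer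
plus a constant, which is the setting of `retraction_decrease`. -/
lemma lagrangian_eq {μ : ℝ} (β : Fin d → ℝ) {X : Fin d → Matrix (Fin n) (Fin p) ℝ}
    {Z : Matrix (Fin n) (Fin p) ℝ} (hX : ∀ i, X i ∈ stiefel n p) (hZ : Z ∈ stiefel n p) :
    lagrangian A μ β X Z =
      1 / 2 * matInner (qMat β X (fun i => multiplier (A i) (X i)) * Z) Z + reg μ Z +
        ∑ i, (β i * p / 2 - 1 / 2 * (A i * (A i)ᵀ * (X i * (X i)ᵀ)).trace) := by
  have h1 : matInner (qMat β X (fun i => multiplier (A i) (X i)) * Z) Z =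
      ∑ i, ((multiplier (A i) (X i) * (Z * Zᵀ)).trace -
        β i * (Z * Zᵀ * (X i * (X i)ᵀ)).trace) := by
    rw [matInner, Matrix.transpose_mul, qMat_transpose, Matrix.mul_assoc, Matrix.trace_mul_comm,
      Matrix.mul_assoc, qMat, Matrix.sum_mul, Matrix.trace_sum]
    refine Finset.sum_congr rfl fun i _ => ?_
    rw [Matrix.sub_mul, Matrix.trace_sub, Matrix.smul_mul, Matrix.trace_smul, smul_eq_mul,
      Matrix.trace_mul_comm (X i * (X i)ᵀ)]
  rw [lagrangian, h1, Finset.mul_sum, add_right_comm, ← Finset.sum_add_distrib]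
  congr 1
  refine Finset.sum_congr rfl fun i _ => ?_
  rw [blockLagrangian, frobNorm_sub_projector_sq (hX i) hZ]
  ring

variable {A} {μ : ℝ} {P : Params d}

lemma lagrangian_retraction_decrease (hμ : 0 ≤ μ) (hs : StepCondition p A μ P)
    (hpen : PenaltyCondition p A μ P) (hM : 0 < Mbar p A μ P)
    {X : Fin d → Matrix (Fin n) (Fin p) ℝ} {Z D Y : Matrix (Fin n) (Fin p) ℝ}
    (hX : ∀ i, X i ∈ stiefel n p) (hZ : Z ∈ stiefel n p) (hD : D ∈ tangentSpace Z)
    (hmin : IsMinOn (proxObjective μ P.η (qMat P.β X fun i => multiplier (A i) (X i)) Z)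
      (tangentSpace Z) D) (hY : IsStiefelProj (Z + D) Y) :
    lagrangian A μ P.β X Y + Mbar p A μ P * frobNorm D ^ 2 ≤ lagrangian A μ P.β X Z := by
  have h1 := frobNorm_qMat_le A (fun i => (hpen.β_pos i).le) hX
  have h2 := retraction_decrease hμ hs.η_pos (qMat_transpose A P.β X) hZ hD hmin hY
    (M := Mbar p A μ P) (by rw [Mbar]; linarith) (hs.two_mul_Mbar_le hM)
  rw [lagrangian_eq A P.β hX hZ, lagrangian_eq A P.β hX hY.mem_stiefel]
  linarith

/-- The global step keeps the local variables close to the global one. -/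
lemma frobNorm_sub_projector_sq_le_of_lagrangian_le (hd : 0 < d) (hμ : 0 ≤ μ)
    (hs : StepCondition p A μ P) (hpen : PenaltyCondition p A μ P)
    {X : Fin d → Matrix (Fin n) (Fin p) ℝ} {Z Y : Matrix (Fin n) (Fin p) ℝ}
    (hX : ∀ i, X i ∈ stiefel n p) (hZ : Z ∈ stiefel n p) (hY : Y ∈ stiefel n p)
    (hdist : ∀ i, P.ρ * d * frobNorm (Z * Zᵀ - X i * (X i)ᵀ) ^ 2 ≤ 1 - P.σ ^ 2)
    (hle : lagrangian A μ P.β X Y ≤ lagrangian A μ P.β X Z) (i : Fin d) :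
    frobNorm (Y * Yᵀ - X i * (X i)ᵀ) ^ 2 ≤ 2 * (1 - P.σ ^ 2) := by
  have hd0 : (0 : ℝ) < d := Nat.cast_pos.2 hd
  have hσ := hs.one_sub_sq_pos
  have h1 : ∀ j, P.β j / 4 * frobNorm (Y * Yᵀ - X j * (X j)ᵀ) ^ 2 -
      P.β j / 4 * frobNorm (Z * Zᵀ - X j * (X j)ᵀ) ^ 2 ≤
      blockLagrangian (A j) (P.β j) (X j) Y - blockLagrangian (A j) (P.β j) (X j) Z +
        2 * √(p : ℝ) * frobNorm (A j) ^ 2 := by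
    intro j
    have h2 := trace_transpose_mul_le (multiplier (A j) (X j)) (Z * Zᵀ - Y * Yᵀ)
    rw [multiplier_transpose, Matrix.mul_sub, Matrix.trace_sub] at h2
    have h3 : frobNorm (multiplier (A j) (X j)) * frobNorm (Z * Zᵀ - Y * Yᵀ) ≤
        2 * frobNorm (A j) ^ 2 * (2 * √(p : ℝ)) :=
      mul_le_mul (frobNorm_multiplier_le (A j) (hX j)) (frobNorm_sub_projector_le hY hZ)
        (frobNorm_nonneg _) (by positivity)
    rw [blockLagrangian, blockLagrangian]
    linarith
  have h4 := Finset.sum_le_sum fun j (_ : j ∈ Finset.univ) => h1 j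
  simp only [Finset.sum_add_distrib, Finset.sum_sub_distrib, ← Finset.mul_sum] at h4
  rw [← frobNorm_dataMatrix_sq] at h4
  -- The factor ρd in `hdist` is used up here: d pays for the sum over the blocks, ρ for comparing β
  -- j with β i.
  have h5 : ∑ j, P.β j / 4 * frobNorm (Z * Zᵀ - X j * (X j)ᵀ) ^ 2 ≤
      P.β i / 4 * (1 - P.σ ^ 2) := by
    have h6 : ∀ j ∈ Finset.univ, P.β j / 4 * frobNorm (Z * Zᵀ - X j * (X j)ᵀ) ^ 2 ≤
        P.β i / 4 * (1 - P.σ ^ 2) / d := by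
      intro j _
      rw [le_div_iff₀ hd0]
      have h7 := mul_le_mul_of_nonneg_left (hdist j) (hpen.β_pos i).le
      have h8 := mul_le_mul_of_nonneg_right (hpen.β_ratio j i)
        (mul_nonneg (sq_nonneg (frobNorm (Z * Zᵀ - X j * (X j)ᵀ))) hd0.le)
      linarith
    refine (Finset.sum_le_sum h6).trans_eq ?_
    rw [Finset.sum_const, Finset.card_univ, Fintype.card_fin, nsmul_eq_mul]
    field_simp
  have h9 : P.β i / 4 * frobNorm (Y * Yᵀ - X i * (X i)ᵀ) ^ 2 ≤
      ∑ j, P.β j / 4 * frobNorm (Y * Yᵀ - X j * (X j)ᵀ) ^ 2 :=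
    Finset.single_le_sum (f := fun j => P.β j / 4 * frobNorm (Y * Yᵀ - X j * (X j)ᵀ) ^ 2)
      (fun j _ => by have := hpen.β_pos j; positivity) (Finset.mem_univ i)
  have h10 := hpen.global_bound hs i
  have h11 := reg_nonneg hμ Y
  have h12 := reg_le_of_mem_stiefel hμ hZ
  have h13 : 0 ≤ μ * n * p := by positivity
  rw [lagrangian, lagrangian] at hle
  -- The old errors account for β(1 - σ²)/4; the regularizer and the multiplier terms account for at
  -- most as much again, by `h10`.
  refine le_of_mul_le_mul_left ?_ (hpen.β_pos i)
  linarith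

/-- One local step: the consensus error contracts and the Lagrangian decreases. -/
lemma local_step (hd : 0 < d) (hs : StepCondition p A μ P) (hpen : PenaltyCondition p A μ P)
    (i : Fin d) {X Y Z : Matrix (Fin n) (Fin p) ℝ} (hX : X ∈ stiefel n p) (hY : Y ∈ stiefel n p)
    (hZ : Z ∈ stiefel n p) (hdist : frobNorm (Z * Zᵀ - X * Xᵀ) ^ 2 ≤ 2 * (1 - P.σ ^ 2))
    (hdec : P.c i / (P.c' i * specNorm (A i) ^ 2 + P.β i) *
        frobNorm (perpProj X * hMat (A i) (P.β i) (multiplier (A i) X) Z * X) ^ 2 ≤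
      localObjective (hMat (A i) (P.β i) (multiplier (A i) X) Z) X -
        localObjective (hMat (A i) (P.β i) (multiplier (A i) X) Z) Y)
    (hkkt : frobNorm (perpProj Y * hMat (A i) (P.β i) (multiplier (A i) X) Z * Y) ≤
      P.δ i * frobNorm (perpProj X * hMat (A i) (P.β i) (multiplier (A i) X) Z * X)) :
    2 * (P.ρ * d) * frobNorm (Z * Zᵀ - Y * Yᵀ) ^ 2 ≤ frobNorm (Z * Zᵀ - X * Xᵀ) ^ 2 ∧
    blockLagrangian (A i) (P.β i) Y Z +
        P.c i * P.σ ^ 2 * P.β i / 8 * frobNorm (Z * Zᵀ - X * Xᵀ) ^ 2 ≤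
      blockLagrangian (A i) (P.β i) X Z := by
  have hdec' := (le_decrease_of_frobNorm_sq_le (A i) (hpen.β_pos i) (hs.c_pos i) (hs.c'_pos i)
    (hpen.c'_mul_le i) hX hZ hdist).trans hdec
  have hdY := frobNorm_sq_le_of_decrease (A i) (hs.c_mul_sq_le_one i) (hpen.local_bound hs i)
    (hpen.β_pos i) hX hY hZ hdist hdec'
  have hcontr := frobNorm_sub_projector_contraction (A i) (hpen.β_pos i) (hs.δ_nonneg i) hs.σ_pos
    (hs.sqrt_pos hd) (hpen.multiplier_bound hs i) (hpen.contraction_bound hs hd i) hX hY hZ hdY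
    hkkt
  refine ⟨?_, blockLagrangian_decrease (A i) (hs.sqrt_pos hd) (hpen.ascent_bound hs hd i) hX hY hZ
    hcontr hdec'⟩
  have h1 := pow_le_pow_left₀ (by positivity [frobNorm_nonneg (Z * Zᵀ - Y * Yᵀ)]) hcontr 2
  rw [mul_pow, mul_pow, hs.sqrt_sq, Real.sq_sqrt (by norm_num)] at h1
  exact h1

variable {Z D : ℕ → Matrix (Fin n) (Fin p) ℝ} {X : ℕ → Fin d → Matrix (Fin n) (Fin p) ℝ}
  {Lam : ℕ → Fin d → Matrix (Fin n) (Fin n) ℝ}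

lemma IsDSSAL1Run.Z_mem (h : IsDSSAL1Run A μ P Z D X Lam) : ∀ k, Z k ∈ stiefel n p
  | 0 => h.Z_zero
  | k + 1 => (h.Z_succ k).mem_stiefel

lemma IsDSSAL1Run.X_mem (h : IsDSSAL1Run A μ P Z D X Lam) : ∀ k i, X k i ∈ stiefel n p
  | 0, i => by rw [h.X_zero i]; exact h.Z_zero
  | k + 1, i => h.X_succ_mem k i

lemma IsDSSAL1Run.Lam_eq (h : IsDSSAL1Run A μ P Z D X Lam) (k : ℕ) :
    Lam k = fun i => multiplier (A i) (X k i) :=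
  funext fun i => h.multiplier_eq k i

/-- The hypothesis on the distances is reproduced for the next iterate: the global step loosens it
to dist² ≤ 2(1 - σ²), and the contraction by 2ρd of the local steps restores it. -/
lemma IsDSSAL1Run.step (h : IsDSSAL1Run A μ P Z D X Lam) (hd : 0 < d) (hμ : 0 ≤ μ)
    (hs : StepCondition p A μ P) (hpen : PenaltyCondition p A μ P) (hM : 0 < Mbar p A μ P) (k : ℕ)
    (hdist : ∀ i, P.ρ * d * frobNorm (Z k * (Z k)ᵀ - X k i * (X k i)ᵀ) ^ 2 ≤ 1 - P.σ ^ 2) :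
    (∀ i, P.ρ * d * frobNorm (Z (k + 1) * (Z (k + 1))ᵀ - X (k + 1) i * (X (k + 1) i)ᵀ) ^ 2 ≤
      1 - P.σ ^ 2) ∧
    lagrangian A μ P.β (X (k + 1)) (Z (k + 1)) + Mbar p A μ P * frobNorm (D k) ^ 2 +
        ∑ i, P.c i * P.σ ^ 2 * P.β i / 8 *
          frobNorm (Z (k + 1) * (Z (k + 1))ᵀ - X (k + 1) i * (X (k + 1) i)ᵀ) ^ 2 ≤
      lagrangian A μ P.β (X k) (Z k) := by
  have hmin := h.D_min k
  rw [h.Lam_eq k] at hmin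
  have h1 := lagrangian_retraction_decrease hμ hs hpen hM (h.X_mem k) (h.Z_mem k) (h.D_mem k) hmin
    (h.Z_succ k)
  have h2 : 0 ≤ Mbar p A μ P * frobNorm (D k) ^ 2 := by positivity
  have h3 := frobNorm_sub_projector_sq_le_of_lagrangian_le hd hμ hs hpen (h.X_mem k) (h.Z_mem k)
    (h.Z_mem (k + 1)) hdist (by linarith)
  have h4 := fun i => local_step hd hs hpen i (h.X_mem k i) (h.X_mem (k + 1) i) (h.Z_mem (k + 1))
    (h3 i) (by simpa only [h.multiplier_eq] using h.X_succ_decrease k i)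
    (by simpa only [h.multiplier_eq] using h.X_succ_kkt k i)
  refine ⟨fun i => by linarith [(h4 i).1, h3 i], ?_⟩
  -- Since 2ρd ≥ 1, the error after the local step is at most the one before it, so the decrease can
  -- be stated with the new error.
  have hρd : 1 ≤ P.ρ * d := by
    have hd1 : (1 : ℝ) ≤ d := by exact_mod_cast hd
    nlinarith [hs.one_le_ρ]
  have h5 : ∀ i ∈ Finset.univ, blockLagrangian (A i) (P.β i) (X (k + 1) i) (Z (k + 1)) +
      P.c i * P.σ ^ 2 * P.β i / 8 *
        frobNorm (Z (k + 1) * (Z (k + 1))ᵀ - X (k + 1) i * (X (k + 1) i)ᵀ) ^ 2 ≤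
      blockLagrangian (A i) (P.β i) (X k i) (Z (k + 1)) := by
    intro i _
    refine le_trans ?_ (h4 i).2
    have hc := hs.c_pos i
    have hβ := hpen.β_pos i
    refine add_le_add le_rfl (mul_le_mul_of_nonneg_left ?_ (by positivity))
    exact (le_mul_of_one_le_left (sq_nonneg _) (by linarith)).trans (h4 i).1
  have h6 := Finset.sum_le_sum h5
  rw [Finset.sum_add_distrib] at h6
  rw [lagrangian] at h1 ⊢
  linarith

lemma IsDSSAL1Run.dist_le (h : IsDSSAL1Run A μ P Z D X Lam) (hd : 0 < d) (hμ : 0 ≤ μ)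
    (hs : StepCondition p A μ P) (hpen : PenaltyCondition p A μ P) (hM : 0 < Mbar p A μ P)
    (k : ℕ) (i : Fin d) :
    P.ρ * d * frobNorm (Z k * (Z k)ᵀ - X k i * (X k i)ᵀ) ^ 2 ≤ 1 - P.σ ^ 2 := by
  induction k generalizing i with
  | zero =>
    have h0 : frobNorm (0 : Matrix (Fin n) (Fin n) ℝ) = 0 := frobNorm_eq_zero.2 rfl
    rw [h.X_zero i, sub_self, h0]
    linarith [hs.one_sub_sq_pos]
  | succ k ih => exact (h.step hd hμ hs hpen hM k ih).1 i

end Iteration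

/-! ### Rates of summable sequences -/

/-- The descent estimate pairs u k with v (k + 1), while the rate concerns equal indices. Shifting
the sum of v recovers the pairs (u k, v k) for 1 ≤ k ≤ K. -/
lemma inf'_Icc_le_div {u v g : ℕ → ℝ} {C : ℝ} (hu : ∀ k, 0 ≤ u k) (hv : ∀ k, 0 ≤ v k)
    (hg : ∀ k, g k ≤ u k + v k)
    (hC : ∀ N, ∑ k ∈ Finset.range N, (u k + v (k + 1)) ≤ C) {K : ℕ} (hK : 1 ≤ K) :
    (Finset.Icc 1 K).inf' (Finset.nonempty_Icc.mpr hK) g ≤ C / K := by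
  have hK0 : (0 : ℝ) < K := by exact_mod_cast hK
  rw [le_div_iff₀ hK0]
  set b := (Finset.Icc 1 K).inf' (Finset.nonempty_Icc.mpr hK) g
  have h1 : ∀ k ∈ Finset.range K, b ≤ u (k + 1) + v (k + 1) := fun k hk =>
    (Finset.inf'_le g (Finset.mem_Icc.2 ⟨by omega, by have := Finset.mem_range.1 hk; omega⟩)).trans
      (hg (k + 1))
  have h2 := Finset.sum_le_sum h1
  rw [Finset.sum_const, Finset.card_range, nsmul_eq_mul, Finset.sum_add_distrib] at h2
  -- K + 1 terms are needed to reach u K; the extra terms u 0 and v (K + 1) are nonnegative.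
  have h3 := hC (K + 1)
  rw [Finset.sum_add_distrib, Finset.sum_range_succ' u, Finset.sum_range_succ (fun k => v (k + 1))]
    at h3
  linarith [hu 0, hv (K + 1)]

end SparsePCA

/-! ### Telescoping the Lagrangian decrease -/

theorem mainTheorem1 {n p d : ℕ} (hp : 0 < p) (hd : 0 < d) {m : Fin d → ℕ}
    (A : ∀ i, Matrix (Fin n) (Fin (m i)) ℝ) (μ : ℝ) (hμ : 0 < μ) (P : SparsePCA.Params d)
    (hstep : SparsePCA.StepCondition p A μ P) (hpen : SparsePCA.PenaltyCondition p A μ P) :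
    ∃ C : ℝ, 0 < C ∧
      ∀ (Z D : ℕ → Matrix (Fin n) (Fin p) ℝ) (X : ℕ → Fin d → Matrix (Fin n) (Fin p) ℝ)
        (Lam : ℕ → Fin d → Matrix (Fin n) (Fin n) ℝ),
        SparsePCA.IsDSSAL1Run A μ P Z D X Lam →
          (∃ Zacc, MapClusterPt Zacc atTop Z) ∧
          (∀ Zacc, MapClusterPt Zacc atTop Z → SparsePCA.IsStationary A μ Zacc) ∧
          ∀ (K : ℕ) (hK : 1 < K),
            (Finset.Icc 1 K).inf' (Finset.nonempty_Icc.mpr hK.le) (fun k =>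
              SparsePCA.frobNorm (D k) ^ 2 +
                1 / (d : ℝ) * ∑ i, SparsePCA.frobNorm (Z k * (Z k)ᵀ - X k i * (X k i)ᵀ) ^ 2) ≤
              C / K := by
  have hM := SparsePCA.Mbar_pos hp hd hμ hpen
  -- κ is a single decrease rate valid for the global step and for every block.
  obtain ⟨κ, hκ, hκM, hκi⟩ : ∃ κ : ℝ, 0 < κ ∧ κ ≤ SparsePCA.Mbar p A μ P ∧
      ∀ i, κ ≤ P.c i * P.σ ^ 2 * P.β i / 8 := by
    have : Nonempty (Fin d) := ⟨⟨0, hd⟩⟩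
    obtain ⟨i₀, hi₀⟩ := Finite.exists_min fun i => P.c i * P.σ ^ 2 * P.β i / 8
    have h1 := hstep.c_pos i₀
    have h2 := hpen.β_pos i₀
    have h3 := hstep.σ_pos
    exact ⟨min (SparsePCA.Mbar p A μ P) (P.c i₀ * P.σ ^ 2 * P.β i₀ / 8),
      lt_min hM (by positivity), min_le_left _ _, fun i => (min_le_right _ _).trans (hi₀ i)⟩
  set B : ℝ := ∑ i, (3 / 2 * SparsePCA.frobNorm (A i) ^ 2 * √(p : ℝ) + P.β i * p) + μ * n * p
  have hB : 0 ≤ B := by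
    have : ∀ i, 0 ≤ P.β i := fun i => (hpen.β_pos i).le
    have : 0 ≤ ∑ i, (3 / 2 * SparsePCA.frobNorm (A i) ^ 2 * √(p : ℝ) + P.β i * p) :=
      Finset.sum_nonneg fun i _ => by have := this i; positivity
    positivity
  -- The Lagrangian stays in [-B, B], so the telescoped decrease is at most 2B whatever the run; the
  -- summand 1 only makes positivity immediate.
  refine ⟨2 * B / κ + 1, by positivity, fun Z D X Lam h => ?_⟩
  set u : ℕ → ℝ := fun k => SparsePCA.frobNorm (D k) ^ 2 with hu
  set v : ℕ → ℝ := fun k => ∑ i, SparsePCA.frobNorm (Z k * (Z k)ᵀ - X k i * (X k i)ᵀ) ^ 2 with hv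
  have hu0 : ∀ k, 0 ≤ u k := fun k => sq_nonneg _
  have hv0 : ∀ k, 0 ≤ v k := fun k => Finset.sum_nonneg fun _ _ => sq_nonneg _
  have hdecr : ∀ k, κ * (u k + v (k + 1)) ≤ SparsePCA.lagrangian A μ P.β (X k) (Z k) -
      SparsePCA.lagrangian A μ P.β (X (k + 1)) (Z (k + 1)) := by
    intro k
    have h1 := (h.step hd hμ.le hstep hpen hM k (h.dist_le hd hμ.le hstep hpen hM k)).2
    have h2 : κ * u k ≤ SparsePCA.Mbar p A μ P * SparsePCA.frobNorm (D k) ^ 2 :=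
      mul_le_mul_of_nonneg_right hκM (hu0 k)
    have h3 : κ * v (k + 1) ≤ ∑ i, P.c i * P.σ ^ 2 * P.β i / 8 *
        SparsePCA.frobNorm (Z (k + 1) * (Z (k + 1))ᵀ - X (k + 1) i * (X (k + 1) i)ᵀ) ^ 2 := by
      simp only [hv, Finset.mul_sum]
      exact Finset.sum_le_sum fun i _ => mul_le_mul_of_nonneg_right (hκi i) (sq_nonneg _)
    linarith
  have habs := fun k => SparsePCA.abs_lagrangian_le A hμ.le (fun i => (hpen.β_pos i).le)
    (h.X_mem k) (h.Z_mem k)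
  have hsum : ∀ N, ∑ k ∈ Finset.range N, (u k + v (k + 1)) ≤ 2 * B / κ := by
    intro N
    rw [le_div_iff₀ hκ, mul_comm, Finset.mul_sum]
    refine (Finset.sum_le_sum fun k _ => hdecr k).trans ?_
    rw [Finset.sum_range_sub' fun k => SparsePCA.lagrangian A μ P.β (X k) (Z k)]
    linarith [(abs_le.1 (habs 0)).2, (abs_le.1 (habs N)).1]
  have hlim : Tendsto (fun k => u k + v (k + 1)) atTop (𝓝 0) :=
    (summable_of_sum_range_le (fun k => add_nonneg (hu0 k) (hv0 (k + 1)))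
      hsum).tendsto_atTop_zero
  have hulim : Tendsto u atTop (𝓝 0) :=
    squeeze_zero hu0 (fun k => le_add_of_nonneg_right (hv0 (k + 1))) hlim
  have hvlim : Tendsto v atTop (𝓝 0) := (tendsto_add_atTop_iff_nat 1).1 <|
    squeeze_zero (fun k => hv0 (k + 1)) (fun k => le_add_of_nonneg_left (hu0 k)) hlim
  refine ⟨SparsePCA.exists_mapClusterPt_of_mem_stiefel h.Z_mem, fun Zacc hZacc => ?_,
    fun K hK => ?_⟩
  · refine SparsePCA.isStationary_of_mapClusterPt A hμ.le (X := X) (β := P.β)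
      (η := P.η) h.Z_mem
      (fun k => ?_) hulim (fun i => ?_) hZacc
    · have h1 := h.D_min k
      rwa [h.Lam_eq k] at h1
    · exact squeeze_zero (fun k => sq_nonneg _) (fun k => Finset.single_le_sum
        (f := fun i => SparsePCA.frobNorm (Z k * (Z k)ᵀ - X k i * (X k i)ᵀ) ^ 2)
        (fun _ _ => sq_nonneg _) (Finset.mem_univ i)) hvlim
  · refine SparsePCA.inf'_Icc_le_div hu0 hv0 (fun k => ?_)
      (fun N => (hsum N).trans (le_add_of_nonneg_right zero_le_one)) hK.le
    have hd1 : (1 : ℝ) ≤ d := by exact_mod_cast hd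
    refine add_le_add le_rfl (mul_le_of_le_one_left (hv0 k) ?_)
    rw [div_le_one (by linarith)]
    exact hd1
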